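/- Conventions. Let $K$ be a field with algebraic closure $\overline K$. A variety in $\mathbb A^n$ is the set $V\subseteq\overline K^n$ of common zeros of a system of polynomials in $n$ variables with coefficients in $\overline K$ (for instance, in $K$); write $V(K)=V\cap K^n$. A variety is irreducible if it is nonempty and is not the union of two varieties properly contained in it. Every variety $W$ can be written, uniquely up to order, as $W=W_1\cup\dots\cup W_m$ with $W_i$ irreducible and $W_i\not\subseteq W_j$ for $i\neq j$; the $W_i$ are the irreducible components of $W$. The dimension of an irreducible variety $V$ is the largest $d$ for which there is a chain $V_0\subsetneq V_1\subsetneq\dots\subsetneq V_d=V$ of irreducible varieties, and the degree of $V$ is the number of points of the intersection of $V$ with a generic linear (affine) subvariety of $\mathbb A^n$ of codimension $d$, generic meaning that the coefficients of its $d$ defining linear equations lie outside the zero set of some nonzero polynomial over $\overline K$. Theorem (escape from subvarieties). For every $m\ge 0$ and all $d_1,\dots,d_m,D_1,\dots,D_m\in\mathbb Z_{\ge 0}$ there are an integer $k\ge 0$ and a real number $c>0$, depending only on $m$, $(d_i)$ and $(D_i)$, such that the following holds. Let $K$ be a field, $n\ge 0$, and let $G$ be a group acting on $K^n$ by linear transformations,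 through a homomorphism $G\to\mathrm{GL}_n(K)$. Let $A\subseteq G$ be a set of generators of $G$. Let $W\subsetneq\mathbb A^n$ be a variety with exactly $m$ irreducible components $W_1,\dots,W_m$, where $\dim W_i=d_i$ and $\deg W_i=D_i$. Let $x\in K^n$ be a point whose orbit $G\cdot x$ is not contained in $W$. Then there are at least $\max(1,c\,|A|)$ elements $g\in(A\cup A^{-1}\cup\{e\})^k$ such that $gx\notin W(K)$. (If $A$ is infinite, this means that there are infinitely many such $g$.) -/

import Mathlib

open scoped Pointwise ENNReal NNReal

namespace Escape

/-- A set of points of affine space `Lⁿ` (with `L` an algebraically closed field in the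
applications) is a variety if it is the set of common zeros of a set of polynomials. -/
def IsVariety {L : Type*} [Field L] {n : ℕ} (V : Set (Fin n → L)) : Prop :=
  ∃ I : Ideal (MvPolynomial (Fin n) L), V = MvPolynomial.zeroLocus L I

/-- A nonempty variety that is not the union of two proper subvarieties. -/
def IsIrreducibleVariety {L : Type*} [Field L] {n : ℕ} (V : Set (Fin n → L)) : Prop :=
  IsVariety V ∧ V.Nonempty ∧
    ∀ V₁ V₂ : Set (Fin n → L), IsVariety V₁ → IsVariety V₂ → V = V₁ ∪ V₂ → V = V₁ ∨ V = V₂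

/-- The dimension: the supremum of the lengths `d` of the chains
`V₀ ⊊ V₁ ⊊ ⋯ ⊊ V_d` of irreducible (nonempty) varieties contained in `V`. -/
noncomputable def dim {L : Type*} [Field L] {n : ℕ} (V : Set (Fin n → L)) : WithBot ℕ∞ :=
  Order.krullDim {U : Set (Fin n → L) // IsIrreducibleVariety U ∧ U ⊆ V}

/-- The linear variety given by the `d` affine linear equations `∑ j, M i j * y j = b i`. -/
def linearVariety {L : Type*} [Field L] {n d : ℕ} (M : Fin d → Fin n → L) (b : Fin d → L) :
    Set (Fin n → L) :=
  {y | ∀ i, ∑ j, M i j * y j = b i}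

/-- `V`, of dimension `d`, has degree `D`: a generic linear variety of codimension `d` meets `V`
in exactly `D` points. "Generic" means: for all systems `(M, b)` of `d` affine linear equations
outside the zero set of some nonzero polynomial `Q` in the coefficients. (For `d ≤ n`, such a
system has rank `d` after `Q` is multiplied by a `d × d` minor of `M`, so it makes no difference
whether the codimension is asked to be exactly `d`.) -/
def HasDegree {L : Type*} [Field L] {n : ℕ} (V : Set (Fin n → L)) (D : ℕ) : Prop :=
  ∃ d : ℕ, dim V = d ∧
    ∃ Q : MvPolynomial ((Fin d × Fin n) ⊕ Fin d) L, Q ≠ 0 ∧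
      ∀ (M : Fin d → Fin n → L) (b : Fin d → L),
        MvPolynomial.eval (Sum.elim (fun p => M p.1 p.2) b) Q ≠ 0 →
          (V ∩ linearVariety M b).encard = D

/-- `V₁, …, V_m` are the irreducible components of `W`: they are irreducible varieties with
union `W`, none of which is contained in another. -/
def AreIrreducibleComponents {L : Type*} [Field L] {n m : ℕ} (W : Set (Fin n → L))
    (V : Fin m → Set (Fin n → L)) : Prop :=
  (∀ i, IsIrreducibleVariety (V i)) ∧ W = ⋃ i, V i ∧ ∀ i j, i ≠ j → ¬ V i ⊆ V j

/-- `W(K)`: the points with coordinates in `K` that lie on `W`. -/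
def rationalPoints (K : Type*) [Field K] {n : ℕ} (W : Set (Fin n → AlgebraicClosure K)) :
    Set (Fin n → K) :=
  {y | (fun i => algebraMap K (AlgebraicClosure K) (y i)) ∈ W}

end Escape

universe u v

/-!
The bounds depend only on the dimensions and degrees of the components, not on the dimension `n` of
the ambient space. The proof first trades the varieties for linear subspaces, where `n` plays no
role.

**Geometry.** Let `V` be an irreducible variety of dimension `d` and degree `D` over an algebraically
closed field. Two facts are needed, with bounds depending only on `d` and `D`:

* `V` is contained in a subspace of bounded dimension (`exists_submodule_finrank_le`);
* `V` is cut out by polynomials of degree at most `(d + 1) D` (`exists_totalDegree_le_of_notMem`).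

Both follow from `exists_relation_totalDegree_le`: any `d + 1` linear forms satisfy a nonzero
relation of degree at most `(d + 1) D` on `V`. For general forms, any `d` of them are a separating
transcendence basis of the function field `F` of `V`. A general fibre of the projection that they
define has as many points as the degree of the extension that they generate in `F`, which is
therefore at most `D`; it bounds the degree in each variable of an irreducible relation. The
existence of a relation of given degree is a determinantal condition, so it passes from general
forms to all of them.

For the first fact, take a general projection of `V` to affine space of dimension `d` and finitely
many points of `V` whose images detect polynomials of degree at most `(d + 1) D` in `d` variables. If a
linear form vanishes at these points, then the terms without it in a minimal relation between it and
the components of the projection vanish as well, so the relation is divisible by the form, which is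
zero on `V` by minimality. For the second fact, a point `y` outside
`V` can be separated from `V` by a linear projection to a space of dimension `d + 1`
(`exists_linComb_forall_valuation_le`), where the image of `V` is a hypersurface, given by a minimal
relation.

**Escape from subspaces.** Let `Y` be a union of boundedly many subspaces of bounded dimension. If
the family of those of maximal dimension is invariant under `G`, the orbit of `x` is contained in
their union or avoids it. Otherwise some generator `a` moves one of them, and `Y ∩ aY` has fewer
subspaces of this dimension, while escaping from `Y ∩ aY` amounts to escaping from `Y`. By induction
(`exists_escapesIn_iUnion_submodule`), either boundedly many words of bounded length suffice to move
every point of the orbit out of `Y`, or the orbit is contained in boundedly many subspaces of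
bounded dimension.

**Escape by linear algebra.** In the second case, polynomials of bounded degree restrict to a space
of functions on the orbit whose dimension is bounded. The span of the translates, by words of
increasing length, of the functions that vanish on `W` becomes stationary, hence invariant, after a
bounded number of steps (`escapesIn_of_orbit_subset`).

Finally, if at most `k` words `b` of length at most `k` move every point of the orbit out of `W`,
then for every `a ∈ A` one of the words `b a` moves `x` out of `W`, and each element of `G` arises
from at most `k` generators `a`. This gives the proportion `1 / (k + 1)`.
-/


/-! ### Escaping in boundedly many steps, and unions of subspaces -/

namespace Escape

/-- `x` escapes from `Y` in `k` steps: there are at most `k` words `b` of length at most `k` in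
`A ∪ A⁻¹` such that every point `g x` of the orbit is moved out of `Y` by one of them. -/
def EscapesIn {L E G : Type*} [Field L] [AddCommGroup E] [Module L E] [Group G]
    (ρ : Representation L G E) (A : Set G) (x : E) (Y : Set E) (k : ℕ) : Prop :=
  ∃ B : Finset G, B.card ≤ k ∧ (B : Set G) ⊆ (A ∪ A⁻¹ ∪ {1}) ^ k ∧
    ∀ g : G, ∃ b ∈ B, ρ (b * g) x ∉ Y

section Escaping

variable {L E G : Type*} [Field L] [AddCommGroup E] [Module L E] [Group G]
  {ρ : Representation L G E} {A : Set G} {x : E}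

theorem one_mem_wordSet (A : Set G) : (1 : G) ∈ A ∪ A⁻¹ ∪ {1} := Or.inr rfl

theorem wordSet_pow_subset (A : Set G) {k l : ℕ} (h : k ≤ l) :
    (A ∪ A⁻¹ ∪ {1}) ^ k ⊆ (A ∪ A⁻¹ ∪ {1}) ^ l :=
  Set.pow_subset_pow_right (one_mem_wordSet A) h

theorem EscapesIn.mono {Y : Set E} {k l : ℕ} (h : EscapesIn ρ A x Y k) (hkl : k ≤ l) :
    EscapesIn ρ A x Y l := by
  obtain ⟨B, hB, hBS, hesc⟩ := h
  exact ⟨B, hB.trans hkl, hBS.trans (wordSet_pow_subset A hkl), hesc⟩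

theorem EscapesIn.anti {Y Y' : Set E} {k : ℕ} (h : EscapesIn ρ A x Y k) (hY : Y' ⊆ Y) :
    EscapesIn ρ A x Y' k := by
  obtain ⟨B, hB, hBS, hesc⟩ := h
  refine ⟨B, hB, hBS, fun g => ?_⟩
  obtain ⟨b, hb, hbY⟩ := hesc g
  exact ⟨b, hb, fun h => hbY (hY h)⟩

theorem escapesIn_of_forall_notMem {Y : Set E} (h : ∀ g, ρ g x ∉ Y) :
    EscapesIn ρ A x Y 1 :=
  ⟨{1}, by simp, by simp, fun g => ⟨1, by simp, by simpa using h g⟩⟩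

/-- Escaping from `Y ∩ aY` in `k` steps means escaping from `Y` in `2 k + 1` steps: if `b g x` is
not in `Y ∩ aY`, then one of `b g x`, `a⁻¹ b g x` is not in `Y`. -/
theorem EscapesIn.of_inter {Y : Set E} {a : G} (ha : a ∈ A) {k : ℕ}
    (h : EscapesIn ρ A x (Y ∩ {z | ρ a⁻¹ z ∈ Y}) k) : EscapesIn ρ A x Y (2 * k + 1) := by
  classical
  obtain ⟨B, hB, hBS, hesc⟩ := h
  refine ⟨B ∪ B.image (a⁻¹ * ·), ?_, ?_, fun g => ?_⟩
  · have h1 := Finset.card_union_le B (B.image (a⁻¹ * ·))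
    have h2 := Finset.card_image_le (s := B) (f := (a⁻¹ * ·))
    omega
  · intro b hb
    simp only [Finset.coe_union, Finset.coe_image, Set.mem_union, Set.mem_image,
      Finset.mem_coe] at hb
    rcases hb with hb | ⟨b, hb, rfl⟩
    · exact wordSet_pow_subset A (by omega) (hBS hb)
    · refine wordSet_pow_subset A (show k + 1 ≤ 2 * k + 1 by omega) ?_
      rw [pow_succ']
      exact Set.mul_mem_mul (Or.inl (Or.inr (by simpa using ha))) (hBS hb)
  · obtain ⟨b, hb, hbY⟩ := hesc g
    by_cases hY : ρ (b * g) x ∈ Y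
    · refine ⟨a⁻¹ * b, Finset.mem_union_right _ (Finset.mem_image_of_mem _ hb),
        fun h => hbY ⟨hY, ?_⟩⟩
      simpa [mul_assoc, map_mul] using h
    · exact ⟨b, Finset.mem_union_left _ hb, hY⟩

/-- If `x` escapes from `Y` in `k` steps, then at least `|A| / k` words of length at most `k + 1`
move `x` out of `Y`: to `a ∈ A` one attaches `b a` with `b a x ∉ Y`, and this is at most `k`
to one. -/
theorem EscapesIn.encard_le {Y : Set E} {k : ℕ} (h : EscapesIn ρ A x Y k) :
    A.encard ≤ k * {g : G | g ∈ (A ∪ A⁻¹ ∪ {1}) ^ (k + 1) ∧ ρ g x ∉ Y}.encard := by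
  obtain ⟨B, hB, hBS, hesc⟩ := h
  set T := {g : G | g ∈ (A ∪ A⁻¹ ∪ {1}) ^ (k + 1) ∧ ρ g x ∉ Y} with hT
  have hsub : A ⊆ ⋃ b ∈ B, (fun g => b⁻¹ * g) '' T := by
    intro a ha
    obtain ⟨b, hb, hbY⟩ := hesc a
    simp only [Set.mem_iUnion, Set.mem_image]
    refine ⟨b, hb, b * a, ⟨?_, hbY⟩, by simp⟩
    rw [pow_succ]
    exact Set.mul_mem_mul (hBS hb) (Or.inl (Or.inl ha))
  have hcard : ∀ C : Finset G, (⋃ b ∈ C, (fun g => b⁻¹ * g) '' T).encard ≤ C.card * T.encard := by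
    classical
    intro C
    induction C using Finset.induction_on with
    | empty => simp
    | insert b C hb ih =>
      rw [Finset.set_biUnion_insert, Finset.card_insert_of_notMem hb]
      refine (Set.encard_union_le _ _).trans ?_
      push_cast
      rw [add_mul, one_mul, add_comm]
      exact add_le_add ih (Set.encard_image_le _ _)
  refine (Set.encard_le_encard hsub).trans ((hcard B).trans ?_)
  gcongr

theorem EscapesIn.one_le_encard {Y : Set E} {k : ℕ} (h : EscapesIn ρ A x Y k) :
    1 ≤ {g : G | g ∈ (A ∪ A⁻¹ ∪ {1}) ^ (k + 1) ∧ ρ g x ∉ Y}.encard := by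
  obtain ⟨B, hB, hBS, hesc⟩ := h
  obtain ⟨b, hb, hbY⟩ := hesc 1
  rw [Set.one_le_encard_iff_nonempty]
  exact ⟨b, wordSet_pow_subset A (Nat.le_succ k) (hBS hb), by simpa using hbY⟩

/-- A finite family of subspaces mapped to itself by generators of `G` is mapped to itself
by `G`. -/
theorem image_map_eq_of_closure_eq_top [DecidableEq (Submodule L E)]
    (hA : Subgroup.closure A = ⊤) {T : Finset (Submodule L E)}
    (hT : ∀ a ∈ A, T.image (Submodule.map (ρ a)) = T) (g : G) :
    T.image (Submodule.map (ρ g)) = T := by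
  have hg : g ∈ Subgroup.closure A := hA ▸ Subgroup.mem_top g
  have hcomp : ∀ g h : G, T.image (Submodule.map (ρ (g * h)))
      = (T.image (Submodule.map (ρ h))).image (Submodule.map (ρ g)) := by
    intro g h
    rw [Finset.image_image]
    congr 1
    ext1 U
    rw [map_mul, Function.comp_apply, ← Submodule.map_comp]
    rfl
  induction hg using Subgroup.closure_induction with
  | mem a ha => exact hT a ha
  | one =>
    have : Submodule.map (ρ (1 : G)) = id := by
      ext1 U; rw [map_one]; exact Submodule.map_id U
    rw [this, Finset.image_id]
  | mul g h _ _ hg hh => rw [hcomp, hh, hg]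
  | inv g _ hg =>
    have := hcomp g⁻¹ g
    rw [hg, inv_mul_cancel] at this
    rw [← this]
    have : Submodule.map (ρ (1 : G)) = id := by
      ext1 U; rw [map_one]; exact Submodule.map_id U
    rw [this, Finset.image_id]

theorem representation_injective (ρ : Representation L G E) (g : G) :
    Function.Injective (ρ g) := by
  intro u v h
  have := congrArg (ρ g⁻¹) h
  simpa using this

end Escaping

/-- **Escape from subspaces.** For a union of at most `s` subspaces of dimension at most `N`, there
is `k`, depending only on `N` and `s`, such that every point escapes from the union in `k` steps
unless its orbit lies in a union of at most `k` subspaces of dimension at most `N`. The induction is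
on `N` and on a bound `t` for the number of subspaces of dimension `N`: if these are permuted by
`G`, then the orbit lies in their union or avoids it; if not, then `Y ∩ aY` has fewer of them for
some generator `a`. -/
theorem exists_escapesIn_iUnion_submodule (N : ℕ) : ∀ t s : ℕ, ∃ k : ℕ,
    ∀ {L : Type u} {E : Type u'} {G : Type v} [Field L] [AddCommGroup E] [Module L E]
      [FiniteDimensional L E] [Group G] (ρ : Representation L G E) (A : Set G) (x : E),
      Subgroup.closure A = ⊤ → ∀ Y : Finset (Submodule L E),
      (∀ U ∈ Y, Module.finrank L U ≤ N) → Y.card ≤ s →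
      (Y.filter (fun U : Submodule L E => Module.finrank L U = N)).card ≤ t →
      (∃ Z : Finset (Submodule L E), Z.card ≤ k ∧ (∀ U ∈ Z, Module.finrank L U ≤ N) ∧
        ∀ g, ∃ U ∈ Z, ρ g x ∈ U) ∨
      EscapesIn ρ A x (⋃ U ∈ Y, (U : Set E)) k := by
  classical
  induction N with
  | zero =>
    intro t s
    refine ⟨s + 1, fun {L E G} _ _ _ _ _ ρ A x hA Y hY hs _ => ?_⟩
    by_cases hx : x = 0
    · refine Or.inl ⟨{⊥}, by simp, by simp, fun g => ⟨⊥, by simp, by simp [hx]⟩⟩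
    · refine Or.inr (EscapesIn.mono (escapesIn_of_forall_notMem fun g hg => ?_)
        (Nat.le_add_left 1 s))
      simp only [Set.mem_iUnion] at hg
      obtain ⟨U, hU, hg⟩ := hg
      have hbot : U = ⊥ := Submodule.finrank_eq_zero.mp (Nat.le_zero.mp (hY U hU))
      rw [hbot] at hg
      refine hx (representation_injective ρ g ?_)
      simpa using hg
  | succ N ihN =>
    intro t
    induction t with
    | zero =>
      intro s
      obtain ⟨k, hk⟩ := ihN s s
      refine ⟨k, fun {L E G} _ _ _ _ _ ρ A x hA Y hY hs ht => ?_⟩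
      have hY' : ∀ U ∈ Y, Module.finrank L U ≤ N := by
        intro U hU
        have h1 := hY U hU
        have h2 : Module.finrank L U ≠ N + 1 := by
          intro h
          rw [Nat.le_zero, Finset.card_eq_zero] at ht
          exact Finset.notMem_empty U (ht ▸ Finset.mem_filter.mpr ⟨hU, h⟩)
        omega
      rcases hk ρ A x hA Y hY' hs ((Finset.card_filter_le _ _).trans hs) with ⟨Z, h1, h2, h3⟩ | h
      · exact Or.inl ⟨Z, h1, fun U hU => (h2 U hU).trans (Nat.le_succ N), h3⟩
      · exact Or.inr h
    | succ t iht =>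
      intro s
      obtain ⟨k₁, hk₁⟩ := ihN s s
      obtain ⟨k₂, hk₂⟩ := iht (s * s)
      refine ⟨max (t + 1) (max k₁ (2 * k₂ + 1)), fun {L E G} _ _ _ _ _ ρ A x hA Y hY hs ht => ?_⟩
      set T := Y.filter (fun U : Submodule L E => Module.finrank L U = N + 1) with hT
      by_cases hinv : ∀ a ∈ A, T.image (Submodule.map (ρ a)) = T
      · have hinv' := image_map_eq_of_closure_eq_top hA hinv
        by_cases hx : ∃ g, ∃ U ∈ T, ρ g x ∈ U
        · obtain ⟨g₀, U₀, hU₀, hx⟩ := hx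
          refine Or.inl ⟨T, ht.trans (le_max_left _ _), fun U hU => ?_, fun g => ?_⟩
          · exact hY U (Finset.mem_filter.mp hU).1
          · refine ⟨U₀.map (ρ (g * g₀⁻¹)), ?_, ?_⟩
            · rw [← hinv' (g * g₀⁻¹)]
              exact Finset.mem_image_of_mem _ hU₀
            · refine ⟨ρ g₀ x, hx, ?_⟩
              rw [← Module.End.mul_apply, ← map_mul]
              simp
        · -- The orbit avoids the subspaces in `T`, and only smaller ones remain.
          push Not at hx
          rcases hk₁ ρ A x hA (Y.filter (fun U : Submodule L E => Module.finrank L U ≠ N + 1))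
            (fun U hU => by
              have h1 := hY U (Finset.mem_filter.mp hU).1
              have h2 := (Finset.mem_filter.mp hU).2
              omega) ((Finset.card_filter_le _ _).trans hs)
              ((Finset.card_filter_le _ _).trans ((Finset.card_filter_le _ _).trans hs))
            with ⟨Z, h1, h2, h3⟩ | h
          · exact Or.inl ⟨Z, h1.trans ((le_max_left _ _).trans (le_max_right _ _)),
              fun U hU => (h2 U hU).trans (Nat.le_succ N), h3⟩
          · refine Or.inr (EscapesIn.mono ?_ ((le_max_left k₁ _).trans (le_max_right (t + 1) _)))
            obtain ⟨B, hB, hBS, hesc⟩ := h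
            refine ⟨B, hB, hBS, fun g => ?_⟩
            obtain ⟨b, hb, hbY⟩ := hesc g
            refine ⟨b, hb, fun hmem => hbY ?_⟩
            simp only [Set.mem_iUnion] at hmem ⊢
            obtain ⟨U, hU, hmem⟩ := hmem
            refine ⟨U, Finset.mem_filter.mpr ⟨hU, fun hdim => ?_⟩, hmem⟩
            exact hx _ U (Finset.mem_filter.mpr ⟨hU, hdim⟩) hmem
      · push Not at hinv
        obtain ⟨a, ha, hne⟩ := hinv
        set f : Submodule L E → Submodule L E := Submodule.map (ρ a) with hf
        have hfin : ∀ U, Module.finrank L (f U) = Module.finrank L U := fun U =>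
          ((Submodule.equivMapOfInjective _ (representation_injective ρ a) U).finrank_eq).symm
        set Y' := Finset.image₂ (· ⊓ ·) Y (Y.image f) with hY'
        have hle : ∀ U ∈ Y', Module.finrank L U ≤ N + 1 := by
          intro U hU
          obtain ⟨U₁, h1, U₂, h2, rfl⟩ := Finset.mem_image₂.mp hU
          exact (Submodule.finrank_mono inf_le_left).trans (hY U₁ h1)
        have hcard : Y'.card ≤ s * s :=
          (Finset.card_image₂_le _ _ _).trans
            (Nat.mul_le_mul hs (Finset.card_image_le.trans hs))
        -- The subspaces of dimension `N + 1` in `Y ∩ aY` belong to both `T` and `aT`, and `aT ≠ T`.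
        have htop : (Y'.filter (fun U : Submodule L E => Module.finrank L U = N + 1)) ⊆
            T ∩ T.image f := by
          intro U hU
          obtain ⟨hU, hdim⟩ := Finset.mem_filter.mp hU
          obtain ⟨U₁, h1, V, hV, rfl⟩ := Finset.mem_image₂.mp hU
          obtain ⟨U₂, h2, rfl⟩ := Finset.mem_image.mp hV
          have e1 : U₁ ⊓ f U₂ = U₁ := Submodule.eq_of_le_of_finrank_le inf_le_left
            (by rw [hdim]; exact hY _ h1)
          have e2 : U₁ ⊓ f U₂ = f U₂ := Submodule.eq_of_le_of_finrank_le inf_le_right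
            (by rw [hdim, hfin]; exact hY _ h2)
          refine Finset.mem_inter.mpr ⟨?_, ?_⟩
          · have hdim₁ : Module.finrank L U₁ = N + 1 := by rw [← hdim, e1]
            change U₁ ⊓ f U₂ ∈ T
            rw [e1]
            exact Finset.mem_filter.mpr ⟨h1, hdim₁⟩
          · have hdim₂ : Module.finrank L U₂ = N + 1 := by rw [← hfin, ← hdim, e2]
            change U₁ ⊓ f U₂ ∈ T.image f
            rw [e2]
            exact Finset.mem_image_of_mem _ (Finset.mem_filter.mpr ⟨h2, hdim₂⟩)
        have hlt : (T ∩ T.image f).card < T.card := by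
          refine Finset.card_lt_card (Finset.ssubset_iff_subset_ne.mpr
            ⟨Finset.inter_subset_left, fun h => hne ?_⟩)
          refine (Finset.eq_of_subset_of_card_le (Finset.inter_eq_left.mp h) ?_).symm
          exact Finset.card_image_le
        rcases hk₂ ρ A x hA Y' hle hcard
            ((Finset.card_le_card htop).trans (by omega)) with ⟨Z, h1, h2, h3⟩ | h
        · exact Or.inl ⟨Z, h1.trans (by omega), h2, h3⟩
        · refine Or.inr (EscapesIn.mono (EscapesIn.of_inter ha (h.anti ?_))
            (show 2 * k₂ + 1 ≤ _ by omega))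
          rintro z ⟨hz, hz'⟩
          simp only [Set.mem_iUnion, Set.mem_ofPred_eq] at hz hz' ⊢
          obtain ⟨U₁, h1, hz⟩ := hz
          obtain ⟨U₂, h2, hz'⟩ := hz'
          refine ⟨U₁ ⊓ f U₂, Finset.mem_image₂_of_mem h1 (Finset.mem_image_of_mem _ h2), hz, ?_⟩
          exact ⟨_, hz', by simp⟩

end Escape

/-! ### Orbits contained in boundedly many subspaces of bounded dimension -/

namespace Escape

open MvPolynomial

theorem totalDegree_bind₁_le {σ τ R : Type*} [CommSemiring R] {p : σ → MvPolynomial τ R}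
    (hp : ∀ i, (p i).totalDegree ≤ 1) (f : MvPolynomial σ R) :
    (bind₁ p f).totalDegree ≤ f.totalDegree := by
  conv_lhs => rw [f.as_sum]
  rw [map_sum]
  refine totalDegree_finsetSum_le fun s hs => ?_
  rw [bind₁_monomial]
  refine (totalDegree_mul _ _).trans ?_
  rw [totalDegree_C, zero_add]
  refine (totalDegree_finsetProd _ _).trans (le_trans ?_ (le_totalDegree hs))
  refine Finset.sum_le_sum fun i _ => (totalDegree_pow _ _).trans ?_
  exact (Nat.mul_le_mul_left _ (hp i)).trans_eq (mul_one _)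

/-- The number of monomials of degree at most `m` in `N` variables. -/
noncomputable def monomialCount (N m : ℕ) : ℕ :=
  Nat.card {s : Fin N →₀ ℕ | (s.sum fun _ e => e) ≤ m}

theorem finrank_restrictTotalDegree (L : Type*) [Field L] (N m : ℕ) :
    Module.finrank L (restrictTotalDegree (Fin N) L m) = monomialCount N m :=
  Module.finrank_eq_nat_card_basis (basisRestrictSupport L _)

/-- The polynomial map `f ↦ f ∘ T` for a linear map `T`. -/
noncomputable def pullback {L : Type*} [Field L] {N n : ℕ} (T : (Fin N → L) →ₗ[L] (Fin n → L)) :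
    MvPolynomial (Fin n) L →ₐ[L] MvPolynomial (Fin N) L :=
  bind₁ fun i => ∑ j, C (T (Pi.single j 1) i) * X j

theorem totalDegree_linear_le {L : Type*} [CommSemiring L] {N : ℕ} (c : Fin N → L) :
    (∑ j, C (c j) * X j : MvPolynomial (Fin N) L).totalDegree ≤ 1 :=
  totalDegree_finsetSum_le fun j _ => (totalDegree_mul _ _).trans (by
    rw [totalDegree_C, zero_add]
    exact (totalDegree_monomial_le _ _).trans (by simp))

theorem totalDegree_pullback_le {L : Type*} [Field L] {N n : ℕ}
    (T : (Fin N → L) →ₗ[L] (Fin n → L)) (f : MvPolynomial (Fin n) L) :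
    (pullback T f).totalDegree ≤ f.totalDegree :=
  totalDegree_bind₁_le (fun _ => totalDegree_linear_le _) f

theorem eval_pullback {L : Type*} [Field L] {N n : ℕ} (T : (Fin N → L) →ₗ[L] (Fin n → L))
    (f : MvPolynomial (Fin n) L) (y : Fin N → L) : eval y (pullback T f) = eval (T y) f := by
  have h : T y = fun i => eval y (∑ j, C (T (Pi.single j 1) i) * X j) := by
    ext i
    conv_lhs => rw [pi_eq_sum_univ' y, map_sum]
    simp [mul_comm]
  rw [pullback, eval, eval₂Hom_bind₁, h]
  rfl

/-- On a set covered by at most `k` subspaces of dimension at most `N`, the polynomial functions of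
degree at most `m` form a space whose dimension is bounded in terms of `k`, `N`, `m`. -/
theorem finrank_range_restrict_le {L G : Type*} [Field L] {n : ℕ} (p : G → Fin n → L) {k N m : ℕ}
    (Z : Finset (Submodule L (Fin n → L))) (hZ : Z.card ≤ k)
    (hZN : ∀ U ∈ Z, Module.finrank L U ≤ N) (hp : ∀ g, ∃ U ∈ Z, p g ∈ U)
    (r : restrictTotalDegree (Fin n) L m →ₗ[L] (G → L))
    (hr : ∀ f g, r f g = eval (p g) (f : MvPolynomial (Fin n) L)) :
    Module.finrank L (LinearMap.range r) ≤ k * monomialCount N m := by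
  have hpar : ∀ U : Z, ∃ T : (Fin N → L) →ₗ[L] (Fin n → L), U.1 ≤ LinearMap.range T := by
    rintro ⟨U, hU⟩
    obtain ⟨i, hi⟩ : ∃ i : U →ₗ[L] (Fin N → L), Function.Injective i :=
      finrank_le_iff_exists_linearMap.mp (by rw [Module.finrank_fin_fun]; exact hZN U hU)
    obtain ⟨q, hq⟩ := i.exists_leftInverse_of_injective (LinearMap.ker_eq_bot.mpr hi)
    refine ⟨U.subtype ∘ₗ q, fun u hu => ⟨i ⟨u, hu⟩, ?_⟩⟩
    have := LinearMap.congr_fun hq ⟨u, hu⟩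
    simp only [LinearMap.comp_apply, LinearMap.id_apply] at this
    simp [this]
  choose T hT using hpar
  let Φ : restrictTotalDegree (Fin n) L m →ₗ[L] (Z → restrictTotalDegree (Fin N) L m) :=
    LinearMap.pi fun U => LinearMap.restrict (pullback (T U)).toLinearMap fun f hf => by
      rw [mem_restrictTotalDegree] at hf ⊢
      exact (totalDegree_pullback_le _ _).trans hf
  have hker : LinearMap.ker Φ ≤ LinearMap.ker r := by
    intro f hf
    rw [LinearMap.mem_ker] at hf ⊢
    ext g
    obtain ⟨U, hU, hg⟩ := hp g
    obtain ⟨y, hy⟩ := hT ⟨U, hU⟩ hg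
    have h0 : pullback (T ⟨U, hU⟩) f.1 = 0 := congrArg Subtype.val (congrFun hf ⟨U, hU⟩)
    rw [hr, ← hy, ← eval_pullback, h0]
    simp
  have h1 : Module.finrank L (LinearMap.range r) ≤ Module.finrank L (LinearMap.range Φ) := by
    have e1 := r.finrank_range_add_finrank_ker
    have e2 := Φ.finrank_range_add_finrank_ker
    have e3 := Submodule.finrank_mono hker
    omega
  refine h1.trans ((Submodule.finrank_le _).trans ?_)
  rw [Module.finrank_pi_fintype]
  simp only [finrank_restrictTotalDegree, Finset.sum_const, smul_eq_mul]
  refine Nat.mul_le_mul_right _ ?_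
  simpa using hZ

/-- In a chain of subspaces with dimensions at most `M`, two consecutive terms agree. -/
theorem exists_eq_succ_of_monotone {L V : Type*} [Field L] [AddCommGroup V] [Module L V]
    {H : Submodule L V} [FiniteDimensional L H] {M : ℕ} (hM : Module.finrank L H ≤ M)
    (U : ℕ → Submodule L V) (hU : Monotone U) (hUH : ∀ j, U j ≤ H) :
    ∃ j ≤ M, U j = U (j + 1) := by
  by_contra! hne
  have hfin : ∀ j, FiniteDimensional L (U j) := fun j => Submodule.finiteDimensional_of_le (hUH j)
  have hgrow : ∀ j ≤ M + 1, j ≤ Module.finrank L (U j) := by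
    intro j
    induction j with
    | zero => simp
    | succ j ih =>
      intro hj
      have hlt : U j < U (j + 1) := lt_of_le_of_ne (hU (Nat.le_succ j)) (hne j (by omega))
      exact (Nat.succ_le_succ (ih (by omega))).trans (Submodule.finrank_lt_finrank_of_lt hlt)
  have h1 := hgrow (M + 1) le_rfl
  have h2 := Submodule.finrank_mono (hUH (M + 1))
  omega

/-- **Escape by linear algebra.** Let `W` be cut out by polynomials of degree at most `m` and let
the orbit of `x` lie in at most `k` subspaces of dimension at most `N`. In the space of functions on
the orbit that come from polynomials of degree at most `m`, the spans of the translates, by words of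
length `j`, of the functions vanishing on `W` form an increasing chain; once it stops growing it is
invariant, so it has no common zero on an orbit not contained in `W`, and a basis consisting of
translates gives the words that escape. -/
theorem escapesIn_of_orbit_subset {L G : Type*} [Field L] [Group G] {n : ℕ}
    (ρ : Representation L G (Fin n → L)) {A : Set G} (hA : Subgroup.closure A = ⊤)
    {x : Fin n → L} {k N m : ℕ} (Z : Finset (Submodule L (Fin n → L))) (hZ : Z.card ≤ k)
    (hZN : ∀ U ∈ Z, Module.finrank L U ≤ N) (hxZ : ∀ g, ∃ U ∈ Z, ρ g x ∈ U)
    {W : Set (Fin n → L)}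
    (hW : ∀ y ∉ W, ∃ f : MvPolynomial (Fin n) L, f.totalDegree ≤ m ∧ (∀ w ∈ W, eval w f = 0) ∧
      eval y f ≠ 0)
    (hx : ∃ g, ρ g x ∉ W) : EscapesIn ρ A x W (k * monomialCount N m) := by
  classical
  set M := k * monomialCount N m
  set S := A ∪ A⁻¹ ∪ {1} with hS
  let r : restrictTotalDegree (Fin n) L m →ₗ[L] (G → L) :=
    LinearMap.pi fun g => (aeval (ρ g x)).toLinearMap ∘ₗ Submodule.subtype _
  have hr : ∀ f g, r f g = eval (ρ g x) (f : MvPolynomial (Fin n) L) := fun f g => by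
    simp [r, aeval_eq_eval]
  have hM : Module.finrank L (LinearMap.range r) ≤ M :=
    finrank_range_restrict_le (fun g => ρ g x) Z hZ hZN hxZ r hr
  -- `τ h u` is the translate `g ↦ u (h g)`; it maps the range of `r` to itself.
  let τ : G → (G → L) →ₗ[L] (G → L) := fun h => LinearMap.funLeft L L (h * ·)
  have hτ : ∀ h u g, τ h u g = u (h * g) := fun _ _ _ => rfl
  have hττ : ∀ h h' u, τ h (τ h' u) = τ (h' * h) u := by
    intro h h' u; ext g; simp [hτ, mul_assoc]
  have hτr : ∀ h f, τ h (r f) ∈ LinearMap.range r := by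
    intro h f
    refine ⟨⟨pullback (ρ h) f.1, ?_⟩, ?_⟩
    · have := f.2
      rw [mem_restrictTotalDegree] at this ⊢
      exact (totalDegree_pullback_le _ _).trans this
    · ext g
      rw [hr, hτ, hr, eval_pullback, map_mul]
      rfl
  let I : Set (restrictTotalDegree (Fin n) L m) := {f | ∀ w ∈ W, eval w f.1 = 0}
  let X : ℕ → Set (G → L) := fun j => {u | ∃ h ∈ S ^ j, ∃ f ∈ I, u = τ h (r f)}
  let U : ℕ → Submodule L (G → L) := fun j => Submodule.span L (X j)
  have hXle : ∀ {i j}, i ≤ j → X i ⊆ X j := by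
    rintro i j hij u ⟨h, hh, f, hf, rfl⟩
    exact ⟨h, wordSet_pow_subset A hij hh, f, hf, rfl⟩
  have hUmono : Monotone U := fun i j hij => Submodule.span_mono (hXle hij)
  have hUH : ∀ j, U j ≤ LinearMap.range r := by
    intro j
    refine Submodule.span_le.mpr ?_
    rintro u ⟨h, -, f, -, rfl⟩
    exact hτr h f
  obtain ⟨j, hjM, hj⟩ := exists_eq_succ_of_monotone hM U hUmono hUH
  have hinvS : ∀ s ∈ S, ∀ u ∈ U j, τ s u ∈ U j := by
    intro s hs u hu
    have hle : U j ≤ (U (j + 1)).comap (τ s) := by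
      refine Submodule.span_le.mpr ?_
      rintro u ⟨h, hh, f, hf, rfl⟩
      refine Submodule.subset_span ⟨h * s, ?_, f, hf, hττ _ _ _⟩
      rw [pow_succ]
      exact Set.mul_mem_mul hh hs
    have := hle hu
    rwa [Submodule.mem_comap, ← hj] at this
  have hinv : ∀ g, ∀ u ∈ U j, τ g u ∈ U j := by
    intro g
    have hg : g ∈ Subgroup.closure A := hA ▸ Subgroup.mem_top g
    induction hg using Subgroup.closure_induction_left with
    | one => exact hinvS 1 (one_mem_wordSet A)
    | mul_left a ha g _ ih =>
      intro u hu
      rw [← hττ]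
      exact ih _ (hinvS a (Or.inl (Or.inl ha)) u hu)
    | inv_mul_cancel a ha g _ ih =>
      intro u hu
      rw [← hττ]
      exact ih _ (hinvS a⁻¹ (Or.inl (Or.inr (by simpa using ha))) u hu)
  have : FiniteDimensional L (U j) := Submodule.finiteDimensional_of_le (hUH j)
  obtain ⟨t, htX, htcard, htspan, -⟩ := Submodule.exists_finset_span_eq_linearIndepOn L (X j)
  have hword : ∀ u ∈ t, ∃ h ∈ S ^ j, ∃ f ∈ I, u = τ h (r f) := fun u hu => htX hu
  choose! w hw f hf hwf using hword
  refine ⟨t.image w, ?_, ?_, fun g => ?_⟩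
  · refine Finset.card_image_le.trans ?_
    rw [htcard]
    exact (Submodule.finrank_mono (hUH j)).trans hM
  · intro b hb
    obtain ⟨u, hu, rfl⟩ := Finset.mem_image.mp hb
    exact wordSet_pow_subset A hjM (hw u hu)
  · obtain ⟨g₀, hg₀⟩ := hx
    obtain ⟨q, hqm, hqW, hq⟩ := hW _ hg₀
    set q' : restrictTotalDegree (Fin n) L m := ⟨q, (mem_restrictTotalDegree _ _ _).mpr hqm⟩
    have hq0 : r q' ∈ U j := by
      refine Submodule.subset_span (hXle (Nat.zero_le j) ⟨1, by simp, q', hqW, ?_⟩)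
      ext g; simp [hτ]
    have hmem := hinv (g₀ * g⁻¹) _ hq0
    have hne : τ (g₀ * g⁻¹) (r q') g ≠ 0 := by
      rw [hτ, hr]; simpa using hq
    by_contra! hcon
    refine hne ?_
    have hle : U j ≤ LinearMap.ker (LinearMap.proj g : (G → L) →ₗ[L] L) := by
      change Submodule.span L (X j) ≤ _
      rw [← htspan]
      refine Submodule.span_le.mpr fun u hu => ?_
      have h1 := hcon (w u) (Finset.mem_image_of_mem w hu)
      change u g = 0
      rw [hwf u hu, hτ, hr]
      exact hf u hu _ h1
    exact hle hmem

end Escape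

/-! ### Dimension of affine varieties and Krull dimension -/

namespace Escape

open MvPolynomial

/-- Integral extensions preserve the dimension, by incomparability and going up. -/
theorem ringKrullDim_eq_of_isIntegral (R S : Type*) [CommRing R] [CommRing S] [Algebra R S]
    [Algebra.IsIntegral R S] [FaithfulSMul R S] : ringKrullDim S = ringKrullDim R := by
  refine le_antisymm ?_ ?_
  · refine Order.krullDim_le_of_strictMono
      (fun p : PrimeSpectrum S => PrimeSpectrum.comap (algebraMap R S) p) fun p q h => ?_
    exact Ideal.IsIntegral.comap_lt_comap (R := R) (I := p.asIdeal) (J := q.asIdeal) h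
  · refine iSup_le fun l => ?_
    obtain ⟨P, hP⟩ := Ideal.nonempty_primesOver (R := R) (S := S) l.head.asIdeal
    have := hP.1
    have := hP.2
    obtain ⟨l', hl', -⟩ := Ideal.exists_ltSeries_of_hasGoingUp l P
    rw [← hl']
    exact Order.LTSeries.length_le_krullDim l'

/-- The Krull dimension of an affine domain is its transcendence degree, by Noether normalization.
It is stated as an equivalence because the two live in different types. -/
theorem trdeg_eq_of_ringKrullDim_eq (k A : Type u) [Field k] [CommRing A] [IsDomain A]
    [Algebra k A] [Algebra.FiniteType k A] {d : ℕ} :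
    ringKrullDim A = d ↔ Algebra.trdeg k A = d := by
  obtain ⟨s, g, hg, hint⟩ := exists_integral_inj_algHom_of_fg k A
  algebraize [g.toRingHom]
  have : FaithfulSMul (MvPolynomial (Fin s) k) A :=
    (faithfulSMul_iff_algebraMap_injective _ _).mpr hg
  have : Algebra.IsIntegral (MvPolynomial (Fin s) k) A := ⟨hint⟩
  have h1 : ringKrullDim A = s := by
    rw [ringKrullDim_eq_of_isIntegral (MvPolynomial (Fin s) k) A]
    simp
  have h2 : Algebra.trdeg k A = s := by
    rw [← trdeg_add_eq k (MvPolynomial (Fin s) k) (A := A),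
      trdeg_eq_zero (R := MvPolynomial (Fin s) k), add_zero]
    simp
  rw [h1, h2]
  norm_cast

section Variety

variable {L : Type u} [Field L] {n : ℕ} {V : Set (Fin n → L)}

theorem zeroLocus_vanishingIdeal (hV : IsVariety V) :
    zeroLocus L (vanishingIdeal L V) = V := by
  obtain ⟨I, rfl⟩ := hV
  exact subset_antisymm (zeroLocus_anti_mono (le_vanishingIdeal_zeroLocus I))
    (zeroLocus_vanishingIdeal_le _)

theorem isPrime_vanishingIdeal (hV : IsIrreducibleVariety V) : (vanishingIdeal L V).IsPrime := by
  obtain ⟨hVar, ⟨v, hv⟩, hirr⟩ := hV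
  refine ⟨fun h => ?_, fun {p q} hpq => ?_⟩
  · have h1 : (1 : MvPolynomial (Fin n) L) ∈ vanishingIdeal L V := h ▸ Submodule.mem_top
    simpa using h1 v hv
  · have hcl : ∀ r : MvPolynomial (Fin n) L, IsVariety (V ∩ {y | aeval y r = 0}) := by
      intro r
      obtain ⟨I, rfl⟩ := hVar
      refine ⟨I ⊔ Ideal.span {r}, ?_⟩
      ext y
      constructor
      · rintro ⟨h1, h2⟩ f hf
        obtain ⟨a, ha, b, hb, rfl⟩ := Submodule.mem_sup.mp hf
        obtain ⟨c, rfl⟩ := Ideal.mem_span_singleton'.mp hb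
        have h2' : aeval y r = 0 := h2
        rw [map_add, h1 a ha, map_mul, h2', mul_zero, add_zero]
      · intro h
        exact ⟨fun f hf => h f (Ideal.mem_sup_left hf),
          h r (Ideal.mem_sup_right (Ideal.mem_span_singleton_self r))⟩
    have hunion : V = (V ∩ {y | aeval y p = 0}) ∪ (V ∩ {y | aeval y q = 0}) := by
      rw [← Set.inter_union_distrib_left]
      refine (Set.inter_eq_left.mpr fun y hy => ?_).symm
      have := hpq y hy
      rwa [map_mul, mul_eq_zero] at this
    rcases hirr _ _ (hcl p) (hcl q) hunion with h | h
    · left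
      intro y hy
      rw [h] at hy
      exact hy.2
    · right
      intro y hy
      rw [h] at hy
      exact hy.2

theorem isIrreducibleVariety_zeroLocus [IsAlgClosed L] (P : Ideal (MvPolynomial (Fin n) L))
    [P.IsPrime] :
    IsIrreducibleVariety (zeroLocus L P) := by
  refine ⟨⟨P, rfl⟩, ?_, ?_⟩
  · by_contra h
    rw [Set.not_nonempty_iff_eq_empty] at h
    have h1 := IsPrime.vanishingIdeal_zeroLocus (K := L) P
    rw [h, vanishingIdeal_empty] at h1
    exact Ideal.IsPrime.ne_top' h1.symm
  · intro V₁ V₂ h1 h2 h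
    have hle : vanishingIdeal L V₁ ⊓ vanishingIdeal L V₂ ≤ P := by
      rw [← IsPrime.vanishingIdeal_zeroLocus (K := L) P, h]
      rintro f ⟨hf1, hf2⟩ y (hy | hy)
      exacts [hf1 y hy, hf2 y hy]
    have hsub1 : V₁ ⊆ zeroLocus L P := h ▸ Set.subset_union_left
    have hsub2 : V₂ ⊆ zeroLocus L P := h ▸ Set.subset_union_right
    rcases (Ideal.IsPrime.inf_le inferInstance).mp hle with hle | hle
    · left
      refine subset_antisymm ?_ hsub1
      rw [← zeroLocus_vanishingIdeal h1]
      exact zeroLocus_anti_mono hle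
    · right
      refine subset_antisymm ?_ hsub2
      rw [← zeroLocus_vanishingIdeal h2]
      exact zeroLocus_anti_mono hle

/-- By the Nullstellensatz, the irreducible subvarieties of `V` correspond to the prime ideals of its
coordinate ring, in the opposite order. -/
theorem dim_eq_ringKrullDim [IsAlgClosed L] (hV : IsIrreducibleVariety V) :
    dim V = ringKrullDim (MvPolynomial (Fin n) L ⧸ vanishingIdeal L V) := by
  rw [ringKrullDim_quotient, ← Order.krullDim_orderDual]
  refine Order.krullDim_eq_of_orderIso
    (OrderIso.ofHomInv
      (α := {U : Set (Fin n → L) // IsIrreducibleVariety U ∧ U ⊆ V})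
      (β := (PrimeSpectrum.zeroLocus (vanishingIdeal L V : Set (MvPolynomial (Fin n) L)))ᵒᵈ)
      (OrderHom.mk (fun U => OrderDual.toDual
        ⟨⟨vanishingIdeal L U.1, isPrime_vanishingIdeal U.2.1⟩, vanishingIdeal_anti_mono U.2.2⟩)
        (fun U U' h => vanishingIdeal_anti_mono h))
      (OrderHom.mk (fun P => ⟨zeroLocus L (OrderDual.ofDual P).1.asIdeal,
        isIrreducibleVariety_zeroLocus _, by
          conv_rhs => rw [← zeroLocus_vanishingIdeal hV.1]
          exact zeroLocus_anti_mono (OrderDual.ofDual P).2⟩)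
        (fun P P' h => zeroLocus_anti_mono h))
      ?_ ?_)
  · refine OrderHom.ext _ _ (funext fun P => ?_)
    refine OrderDual.ofDual_inj.mp (Subtype.ext (PrimeSpectrum.ext ?_))
    exact IsPrime.vanishingIdeal_zeroLocus (K := L) (OrderDual.ofDual P).1.asIdeal
  · exact OrderHom.ext _ _ (funext fun U => Subtype.ext (zeroLocus_vanishingIdeal U.2.1.1))

end Variety

end Escape

/-! ### Points over a general point of the base of a finite separable extension -/

namespace Escape

open Polynomial

/-- **Points over a general point.** Let `F` be a finite separable extension of the fraction field
`E` of `P`, generated by `x`. For a homomorphism `χ` from `P` to an algebraically closed field that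
does not kill a certain `h ≠ 0`, the family `x` has at least `[F : E]` specializations along `χ`.
With `F = E(θ)` and `x = g(θ)`, they are the `g(τ)` for the roots `τ` of the specialization of the
minimal polynomial of `θ`; to be defined over `Localization.Away h`, it suffices that `h` is a
common denominator of the polynomials involved. -/
theorem exists_forall_finrank_le_encard {P E F : Type*} [CommRing P] [IsDomain P] [Field E]
    [Algebra P E] [IsFractionRing P E] [Field F] [Algebra E F] [FiniteDimensional E F]
    [Algebra.IsSeparable E F] {ι : Type*} [Finite ι] (x : ι → F)
    (hx : Algebra.adjoin E (Set.range x) = ⊤) :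
    ∃ h : P, h ≠ 0 ∧ ∀ {L : Type u} [Field L] [IsAlgClosed L] (χ : P →+* L), χ h ≠ 0 →
      (Module.finrank E F : ℕ∞) ≤ {y : ι → L | ∀ q : MvPolynomial ι P,
        MvPolynomial.eval₂ ((algebraMap E F).comp (algebraMap P E)) x q = 0 →
          MvPolynomial.eval₂ χ y q = 0}.encard := by
  classical
  obtain ⟨θ, hθ⟩ := Field.exists_primitive_element E F
  have hint : IsIntegral E θ := Algebra.IsIntegral.isIntegral θ
  set f := minpoly E θ with hf
  have hadj : ∀ z : F, ∃ g : E[X], aeval θ g = z := by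
    intro z
    have : z ∈ Algebra.adjoin E {θ} := by
      rw [← IntermediateField.adjoin_simple_toSubalgebra_of_isAlgebraic hint.isAlgebraic, hθ]
      trivial
    rwa [Algebra.adjoin_singleton_eq_range_aeval] at this
  choose g hg using fun i => hadj (x i)
  have hsep : f.Separable := Algebra.IsSeparable.isSeparable E θ
  obtain ⟨u, v, huv⟩ := hsep
  obtain ⟨Θ, hΘ⟩ : ∃ Θ : MvPolynomial ι E, MvPolynomial.aeval x Θ = θ := by
    have : θ ∈ Algebra.adjoin E (Set.range x) := hx ▸ Algebra.mem_top
    rwa [Algebra.adjoin_range_eq_range_aeval] at this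
  -- A common denominator of all coefficients involved.
  have := Fintype.ofFinite ι
  set S : Finset E := f.coeffs ∪ u.coeffs ∪ v.coeffs ∪ (Finset.univ.biUnion fun i => (g i).coeffs) ∪
    Θ.support.image Θ.coeff with hS
  obtain ⟨⟨h, hh⟩, hden⟩ := IsLocalization.exist_integer_multiples_of_finset (nonZeroDivisors P) S
  have hh0 : h ≠ 0 := nonZeroDivisors.ne_zero hh
  refine ⟨h, hh0, fun {L} _ _ χ hχ => ?_⟩
  let R := Localization.Away h
  have hE0 : algebraMap P E h ≠ 0 := by
    rwa [Ne, map_eq_zero_iff _ (IsFractionRing.injective P E)]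
  have hhE : IsUnit (algebraMap P E h) := hE0.isUnit
  let i : R →+* E := IsLocalization.Away.lift h hhE
  let χ' : R →+* L := IsLocalization.Away.lift h hχ.isUnit
  have hi : ∀ c, i (algebraMap P R c) = algebraMap P E c := IsLocalization.Away.lift_eq h hhE
  have hχ' : ∀ c, χ' (algebraMap P R c) = χ c := IsLocalization.Away.lift_eq h hχ.isUnit
  have hinj : Function.Injective i := by
    refine (injective_iff_map_eq_zero i).mpr fun z hz => ?_
    obtain ⟨c, s, rfl⟩ := IsLocalization.exists_mk'_eq (Submonoid.powers h) z
    have h1 : i (algebraMap P R c) = 0 := by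
      rw [← IsLocalization.mk'_spec R c s, map_mul, hz, zero_mul]
    rw [hi, map_eq_zero_iff _ (IsFractionRing.injective P E)] at h1
    rw [h1, IsLocalization.mk'_zero]
  have hrange : ∀ z ∈ insert 0 S, z ∈ Set.range i := by
    intro z hz
    rcases Finset.mem_insert.mp hz with rfl | hz
    · exact ⟨0, map_zero i⟩
    obtain ⟨c, hc⟩ := hden z hz
    refine ⟨IsLocalization.Away.invSelf h * algebraMap P R c, hE0.isUnit.mul_left_cancel ?_⟩
    rw [map_mul, ← mul_assoc, ← hi h, ← map_mul i, IsLocalization.Away.mul_invSelf, map_one,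
      one_mul, hi, hi, hc]
    exact Algebra.smul_def h z
  have hlift : ∀ p : E[X], p.coeffs ⊆ S → ∃ p' : R[X], p'.map i = p := by
    intro p hp
    refine (Polynomial.mem_lifts p).mp ((Polynomial.lifts_iff_coeff_lifts p).mpr fun k => ?_)
    refine hrange _ (Finset.mem_insert.mpr ?_)
    by_cases hk : p.coeff k = 0
    · exact Or.inl hk
    · exact Or.inr (hp (coeff_mem_coeffs hk))
  obtain ⟨f', hf'⟩ := hlift f (by intro z hz; simp [hS, hz])
  obtain ⟨u', hu'⟩ := hlift u (by intro z hz; simp [hS, hz])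
  obtain ⟨v', hv'⟩ := hlift v (by intro z hz; simp [hS, hz])
  choose g' hg' using fun j => hlift (g j) (by
    intro z hz
    simp only [hS, Finset.mem_union, Finset.mem_biUnion]
    exact Or.inl (Or.inr ⟨j, Finset.mem_univ j, hz⟩))
  obtain ⟨Θ', hΘ'⟩ : Θ ∈ Set.range (MvPolynomial.map (σ := ι) i) := by
    rw [MvPolynomial.mem_range_map_iff_coeffs_subset]
    intro z hz
    refine hrange z (Finset.mem_insert_of_mem ?_)
    simp only [hS, Finset.mem_union]
    right
    rw [← MvPolynomial.coeffs]
    exact hz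
  have hmonic : f'.Monic := by
    rw [hinj.monic_map_iff, hf']
    exact minpoly.monic hint
  let ψ : R[X] →+* F := eval₂RingHom ((algebraMap E F).comp i) θ
  have hψ : ∀ p : R[X], ψ p = aeval θ (p.map i) := by
    intro p
    simp [ψ, aeval_def, eval₂_map]
  -- A relation of `θ` over `R` is a multiple of `f'`, so every root of `f'` satisfies it.
  have hkey : ∀ τ, eval₂ χ' τ f' = 0 → ∀ p : R[X], ψ p = 0 → eval₂ χ' τ p = 0 := by
    intro τ hτ p hp
    rw [hψ] at hp
    have hdvd := minpoly.dvd E θ hp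
    rw [← hf, ← hf', Polynomial.map_dvd_map i hinj hmonic] at hdvd
    obtain ⟨w, rfl⟩ := hdvd
    rw [eval₂_mul, hτ, zero_mul]
  have hψg : ∀ j, ψ (g' j) = x j := fun j => by rw [hψ, hg', hg]
  let y : L → ι → L := fun τ j => eval₂ χ' τ (g' j)
  have hyΘ : ∀ τ, eval₂ χ' τ f' = 0 → MvPolynomial.eval₂ χ' (y τ) Θ' = τ := by
    intro τ hτ
    have h0 : ψ (MvPolynomial.eval₂ C g' Θ' - X) = 0 := by
      rw [map_sub, MvPolynomial.eval₂_comp_left]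
      have e1 : ψ.comp C = (algebraMap E F).comp i := by ext; simp [ψ]
      have e2 : ψ ∘ g' = x := funext hψg
      have e3 : ψ X = θ := by simp [ψ]
      rw [e1, e2, e3, sub_eq_zero, ← hΘ, ← hΘ', MvPolynomial.aeval_def, MvPolynomial.eval₂_map]
    have h1 := hkey τ hτ _ h0
    rw [eval₂_sub, eval₂_X, sub_eq_zero] at h1
    refine Eq.trans ?_ h1
    change _ = eval₂RingHom χ' τ _
    rw [MvPolynomial.eval₂_comp_left]
    congr 1
    ext; simp
  have hsep' : (f'.map χ').Separable := by
    have h1 : u' * f' + v' * derivative f' = 1 := by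
      refine Polynomial.map_injective i hinj ?_
      rw [Polynomial.map_add, Polynomial.map_mul, Polynomial.map_mul, ← derivative_map, hf', hu',
        hv', Polynomial.map_one, huv]
    refine ⟨u'.map χ', v'.map χ', ?_⟩
    rw [derivative_map, ← Polynomial.map_mul, ← Polynomial.map_mul, ← Polynomial.map_add, h1,
      Polynomial.map_one]
  have hcard : (f'.map χ').roots.toFinset.card = Module.finrank E F := by
    rw [Multiset.toFinset_card_of_nodup (nodup_roots hsep'),
      ← (IsAlgClosed.splits (f'.map χ')).natDegree_eq_card_roots, hmonic.natDegree_map,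
      ← hmonic.natDegree_map i, hf', hf]
    exact ((Field.primitive_element_iff_minpoly_natDegree_eq E θ).mp hθ)
  have hroot : ∀ τ ∈ (f'.map χ').roots.toFinset, eval₂ χ' τ f' = 0 := by
    intro τ hτ
    rw [Multiset.mem_toFinset, mem_roots', IsRoot.def, eval_map] at hτ
    exact hτ.2
  rw [← hcard, ← Set.encard_coe_eq_coe_finsetCard]
  have hyinj : Set.InjOn y ((f'.map χ').roots.toFinset : Set L) := by
    intro τ hτ τ' hτ' heq
    rw [← hyΘ τ (hroot τ hτ), ← hyΘ τ' (hroot τ' hτ'), heq]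
  rw [← hyinj.encard_image]
  refine Set.encard_le_encard ?_
  rintro _ ⟨τ, hτ, rfl⟩ q hq
  have h0 : ψ (MvPolynomial.eval₂ (C.comp (algebraMap P R)) g' q) = 0 := by
    rw [MvPolynomial.eval₂_comp_left]
    have e1 : ψ.comp (C.comp (algebraMap P R)) = (algebraMap E F).comp (algebraMap P E) := by
      ext c; simp [ψ, hi]
    have e2 : ψ ∘ g' = x := funext hψg
    rw [e1, e2, hq]
  have h1 := hkey τ (hroot τ hτ) _ h0
  change eval₂RingHom χ' τ _ = 0 at h1
  rw [MvPolynomial.eval₂_comp_left] at h1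
  rw [← h1]
  congr 1
  ext c; simp [hχ']

end Escape

/-! ### Separating transcendence bases made of general linear forms -/

namespace Escape

open KaehlerDifferential

/-- The linear forms with coefficient matrix `M`, evaluated at `x`. -/
def linComb {L F : Type*} [Field L] [Field F] [Algebra L F] {n : ℕ} {ι : Type*} (x : Fin n → F)
    (M : ι → Fin n → L) (i : ι) : F :=
  ∑ j, M i j • x j

section Differentials

variable {L F : Type u} [Field L] [Field F] [Algebra L F]

theorem D_mem_span_of_mem_adjoin (S : Set F) {z : F} (hz : z ∈ IntermediateField.adjoin L S) :
    D L F z ∈ Submodule.span F (D L F '' S) := by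
  induction hz using IntermediateField.adjoin_induction with
  | mem z hz => exact Submodule.subset_span ⟨z, hz, rfl⟩
  | algebraMap a => rw [Derivation.map_algebraMap]; exact zero_mem _
  | add a b _ _ ha hb => rw [map_add]; exact add_mem ha hb
  | inv a _ ha =>
    rw [Derivation.leibniz_inv]
    exact Submodule.smul_mem _ _ ha
  | mul a b _ _ ha hb =>
    rw [Derivation.leibniz]
    exact add_mem (Submodule.smul_mem _ _ hb) (Submodule.smul_mem _ _ ha)

theorem span_D_eq_top_of_adjoin_eq_top {S : Set F} (hS : IntermediateField.adjoin L S = ⊤) :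
    Submodule.span F (D L F '' S) = ⊤ := by
  rw [eq_top_iff, ← span_range_derivation, Submodule.span_le]
  rintro _ ⟨z, rfl⟩
  exact D_mem_span_of_mem_adjoin S (hS ▸ IntermediateField.mem_top)

/-- If `F` is separable over `L(S)`, then it has no differentials over `L(S)`, so those over `L` come
from `L(S)`. -/
theorem span_D_eq_top_of_isSeparable (S : Set F)
    [Algebra.IsSeparable (IntermediateField.adjoin L S) F]
    [Algebra.EssFiniteType L F] : Submodule.span F (D L F '' S) = ⊤ := by
  set E := IntermediateField.adjoin L S
  have : Algebra.EssFiniteType E F := Algebra.EssFiniteType.of_comp L E F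
  have : Algebra.FormallyUnramified E F := Algebra.FormallyUnramified.of_isSeparable E F
  rw [Submodule.eq_top_iff']
  intro ω
  have hω : LinearMap.range (mapBaseChange L E F) = ⊤ := by
    rw [range_mapBaseChange, LinearMap.ker_eq_top]
    ext z
    exact Subsingleton.elim _ _
  obtain ⟨t, rfl⟩ : ω ∈ LinearMap.range (mapBaseChange L E F) := hω ▸ Submodule.mem_top
  induction t using TensorProduct.induction_on with
  | zero => rw [map_zero]; exact zero_mem _
  | add a b ha hb => rw [map_add]; exact add_mem ha hb
  | tmul a b =>
    rw [mapBaseChange_tmul]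
    refine Submodule.smul_mem _ _ ?_
    have hb : b ∈ Submodule.span E (Set.range (D L E)) :=
      span_range_derivation L E ▸ Submodule.mem_top
    induction hb using Submodule.span_induction with
    | mem b hb =>
      obtain ⟨e, rfl⟩ := hb
      rw [map_D]
      exact D_mem_span_of_mem_adjoin S e.2
    | zero => rw [map_zero]; exact zero_mem _
    | add b c _ _ hb hc => rw [map_add]; exact add_mem hb hc
    | smul e b _ hb =>
      rw [map_smul, ← algebraMap_smul F e]
      exact Submodule.smul_mem _ _ hb

/-- If the differentials of `S` generate `Ω[F⁄L]`, then `F` has no differentials over `L(S)`, so it is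
unramified, and therefore separable. -/
theorem isSeparable_of_span_D_eq_top [Algebra.EssFiniteType L F] {S : Set F}
    (hS : Submodule.span F (D L F '' S) = ⊤) :
    Algebra.IsSeparable (IntermediateField.adjoin L S) F := by
  set E := IntermediateField.adjoin L S
  have : Algebra.EssFiniteType E F := Algebra.EssFiniteType.of_comp L E F
  rw [← Algebra.FormallyUnramified.iff_isSeparable]
  refine ⟨⟨fun a b => ?_⟩⟩
  suffices h : ∀ a : Ω[F⁄E], a = 0 by rw [h a, h b]
  intro a
  obtain ⟨ω, rfl⟩ := map_surjective L E F a
  have hω : ω ∈ Submodule.span F (D L F '' S) := hS ▸ Submodule.mem_top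
  induction hω using Submodule.span_induction with
  | mem _ h =>
    obtain ⟨z, hz, rfl⟩ := h
    rw [map_D]
    exact (D E F).map_algebraMap (⟨z, IntermediateField.subset_adjoin L S hz⟩ : E)
  | zero => exact map_zero _
  | add a b _ _ ha hb => rw [map_add, ha, hb, add_zero]
  | smul c a _ ha => rw [map_smul, ha, smul_zero]

/-- Over a perfect field, the differentials of a separating transcendence basis generate. -/
theorem finrank_kaehlerDifferential_le [PerfectField L] [Algebra.EssFiniteType L F] {d : ℕ}
    (hd : Algebra.trdeg L F = d) : Module.finrank F Ω[F⁄L] ≤ d := by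
  classical
  obtain ⟨s, hs, hsep⟩ := exists_isTranscendenceBasis_and_isSeparable_of_perfectField L F
  have hcard : s.card = d := by
    have := hs.cardinalMk_eq_trdeg
    rw [hd] at this
    simpa using this
  have hspan := span_D_eq_top_of_isSeparable (L := L) (s : Set F)
  rw [← finrank_top, ← hspan, ← hcard]
  rw [← Finset.coe_image]
  exact (finrank_span_finset_le_card _).trans Finset.card_image_le

end Differentials

/-- If `v` spans a space of dimension at most `d`, then `d` general linear combinations of `v`
span it as well. -/
theorem exists_mvPolynomial_span_eq_top {F V : Type*} [Field F] [AddCommGroup V] [Module F V]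
    [FiniteDimensional F V] {d n : ℕ} (hd : Module.finrank F V ≤ d) (v : Fin n → V)
    (hv : Submodule.span F (Set.range v) = ⊤) :
    ∃ R : MvPolynomial (Fin d × Fin n) F, R ≠ 0 ∧ ∀ M : Fin d → Fin n → F,
      MvPolynomial.eval (fun p => M p.1 p.2) R ≠ 0 →
        Submodule.span F (Set.range fun i => ∑ j, M i j • v j) = ⊤ := by
  classical
  set e := Module.finrank F V
  let b : Module.Basis (Fin e) F V := Module.finBasis F V
  let ι : Fin e → Fin d := Fin.castLE hd
  let R : MvPolynomial (Fin d × Fin n) F := Matrix.det (Matrix.of fun c a : Fin e =>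
    ∑ j, MvPolynomial.X (ι a, j) * MvPolynomial.C (b.repr (v j) c))
  have hR : ∀ M : Fin d → Fin n → F, MvPolynomial.eval (fun p => M p.1 p.2) R =
      b.det (fun a => ∑ j, M (ι a) j • v j) := by
    intro M
    rw [Module.Basis.det_apply, RingHom.map_det]
    congr 1
    ext c a
    simp [Module.Basis.toMatrix_apply]
  refine ⟨R, fun h0 => ?_, fun M hM => ?_⟩
  · have hc : ∀ a, ∃ c : Fin n → F, ∑ j, c j • v j = b a := fun a =>
      (Submodule.mem_span_range_iff_exists_fun F).mp (hv ▸ Submodule.mem_top)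
    choose c hc using hc
    have h1 := hR (fun i => if h : i.1 < e then c ⟨i.1, h⟩ else 0)
    rw [h0, map_zero] at h1
    have h2 : (fun a => ∑ j, (if h : (ι a).1 < e then c ⟨(ι a).1, h⟩ else 0) j • v j) = b := by
      ext1 a
      have : (ι a).1 < e := a.2
      simp only [this, dif_pos]
      exact hc a
    rw [h2, Module.Basis.det_self] at h1
    exact zero_ne_one h1
  · rw [hR] at hM
    have h1 := (b.is_basis_iff_det.mpr hM.isUnit).2
    rw [eq_top_iff, ← h1, Submodule.span_le]
    rintro _ ⟨a, rfl⟩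
    exact Submodule.subset_span ⟨ι a, rfl⟩

/-- A general choice of `d = trdeg F` linear forms in a generating family `x` of `F` is a
transcendence basis over which `F` is separable: it suffices that the differentials of the forms
generate the module of differentials. -/
theorem exists_mvPolynomial_isSeparable {L F : Type u} [Field L] [Field F] [Algebra L F]
    [PerfectField L] [Algebra.EssFiniteType L F] {d n : ℕ} (hd : Algebra.trdeg L F = d)
    (x : Fin n → F) (hx : IntermediateField.adjoin L (Set.range x) = ⊤) :
    ∃ R : MvPolynomial (Fin d × Fin n) F, R ≠ 0 ∧ ∀ M : Fin d → Fin n → L,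
      MvPolynomial.eval (fun p => algebraMap L F (M p.1 p.2)) R ≠ 0 →
        Algebra.IsSeparable (IntermediateField.adjoin L (Set.range (linComb x M))) F ∧
        AlgebraicIndependent L (linComb x M) := by
  have hspan : Submodule.span F (Set.range fun j => D L F (x j)) = ⊤ := by
    rw [← span_D_eq_top_of_adjoin_eq_top hx, ← Set.range_comp]
    rfl
  have := KaehlerDifferential.finite L F
  obtain ⟨R, hR0, hR⟩ :=
    exists_mvPolynomial_span_eq_top (finrank_kaehlerDifferential_le hd) _ hspan
  refine ⟨R, hR0, fun M hM => ?_⟩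
  have h1 := hR (fun i j => algebraMap L F (M i j)) hM
  have h2 : (fun i => ∑ j, algebraMap L F (M i j) • D L F (x j))
      = fun i => D L F (linComb x M i) := by
    ext1 i
    rw [linComb, map_sum]
    exact Finset.sum_congr rfl fun j _ => by rw [Derivation.map_smul, algebraMap_smul]
  have h3 : Submodule.span F (D L F '' Set.range (linComb x M)) = ⊤ := by
    rw [← Set.range_comp, ← h1, h2]
    rfl
  have hsep := isSeparable_of_span_D_eq_top h3
  refine ⟨hsep, ?_⟩
  have halg : Algebra.IsAlgebraic (Algebra.adjoin L (Set.range (linComb x M))) F := by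
    rw [← IntermediateField.isAlgebraic_adjoin_iff_top]
    infer_instance
  exact (Algebra.IsAlgebraic.isTranscendenceBasis_of_lift_le_trdeg_of_finite L (linComb x M)
    (by rw [hd]; simp)).1

end Escape

/-! ### Generic points and general linear projections -/

namespace Escape

open MvPolynomial

/-- `x`, with coordinates in an extension `F` of `L`, is a generic point of `V`: the polynomials
over `L` that vanish at `x` are those that vanish on `V`. -/
def IsGenericPoint {L F : Type*} [Field L] [Field F] [Algebra L F] {n : ℕ} (V : Set (Fin n → L))
    (x : Fin n → F) : Prop :=
  ∀ q : MvPolynomial (Fin n) L, aeval x q = 0 ↔ ∀ y ∈ V, aeval y q = 0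

/-- The classes of the coordinates in the function field of `V` are a generic point. -/
theorem exists_isGenericPoint {L : Type u} [Field L] [IsAlgClosed L] {n d : ℕ}
    {V : Set (Fin n → L)} (hV : IsIrreducibleVariety V) (hd : dim V = d) :
    ∃ (F : Type u) (_ : Field F) (_ : Algebra L F) (_ : Algebra.EssFiniteType L F) (x : Fin n → F),
      IsGenericPoint V x ∧ IntermediateField.adjoin L (Set.range x) = ⊤ ∧
      Algebra.trdeg L F = d := by
  have := isPrime_vanishingIdeal hV
  let A := MvPolynomial (Fin n) L ⧸ vanishingIdeal L V
  have hA : Algebra.FiniteType L A := inferInstance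
  let F := FractionRing A
  have : Algebra.EssFiniteType A F := Algebra.EssFiniteType.of_isLocalization F (nonZeroDivisors A)
  have : Algebra.EssFiniteType L F := Algebra.EssFiniteType.comp L A F
  let x : Fin n → F := fun i => algebraMap A F (Ideal.Quotient.mk _ (X i))
  have hx : ∀ q : MvPolynomial (Fin n) L, aeval x q = algebraMap A F (Ideal.Quotient.mk _ q) := by
    intro q
    have h : aeval x = ((IsScalarTower.toAlgHom L A F).comp
        (Ideal.Quotient.mkₐ L (vanishingIdeal L V))) := by
      ext i; simp [x]; rfl
    rw [h]; rfl
  refine ⟨F, inferInstance, inferInstance, inferInstance, x, fun q => ?_, ?_, ?_⟩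
  · rw [hx, map_eq_zero_iff _ (IsFractionRing.injective A F), Ideal.Quotient.eq_zero_iff_mem]
    rfl
  · rw [eq_top_iff]
    rintro z -
    have hmem : ∀ a : A, algebraMap A F a ∈ IntermediateField.adjoin L (Set.range x) := by
      intro a
      obtain ⟨q, rfl⟩ := Ideal.Quotient.mk_surjective a
      rw [← hx]
      refine IntermediateField.algebra_adjoin_le_adjoin L _ ?_
      rw [Algebra.adjoin_range_eq_range_aeval]
      exact ⟨q, rfl⟩
    obtain ⟨a, b, -, rfl⟩ := IsFractionRing.div_surjective (A := A) z
    exact div_mem (hmem a) (hmem b)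
  · have h1 : Algebra.trdeg L A = d := by
      rw [← trdeg_eq_of_ringKrullDim_eq, ← dim_eq_ringKrullDim hV, hd]
    have : Algebra.IsAlgebraic A F := IsLocalization.isAlgebraic F (nonZeroDivisors A)
    rw [← trdeg_add_eq L A (A := F), trdeg_eq_zero (R := A), add_zero, h1]

theorem aeval_bind₁_linear {L F : Type*} [Field L] [Field F] [Algebra L F] {n : ℕ} {ι : Type*}
    (M : ι → Fin n → L) (f : MvPolynomial ι L) (z : Fin n → F) :
    aeval z (bind₁ (fun i => ∑ j, C (M i j) * X j) f) = aeval (linComb z M) f := by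
  rw [aeval_bind₁]
  congr 2
  ext i
  simp [linComb, Algebra.smul_def]

theorem IsGenericPoint.aeval_linComb {L F : Type*} [Field L] [Field F] [Algebra L F] {n : ℕ}
    {V : Set (Fin n → L)} {x : Fin n → F} (hx : IsGenericPoint V x) {ι : Type*}
    (M : ι → Fin n → L) (f : MvPolynomial ι L) :
    aeval (linComb x M) f = 0 ↔ ∀ y ∈ V, aeval (linComb y M) f = 0 := by
  simp only [← aeval_bind₁_linear]
  exact hx _

/-- The linear map with coefficient matrix `M` is a good projection of `V` for the degree bound `D`:
at the generic point `x` of `V`, its components are algebraically independent, the degree of the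
function field over the subfield that they generate is at most `D`, and a general point of the
target is the image of a point of `V`. -/
structure IsGoodProjection {L F : Type*} [Field L] [Field F] [Algebra L F] {n d : ℕ}
    (V : Set (Fin n → L)) (x : Fin n → F) (D : ℕ) (M : Fin d → Fin n → L) : Prop where
  algebraicIndependent : AlgebraicIndependent L (linComb x M)
  finiteDimensional : FiniteDimensional (IntermediateField.adjoin L (Set.range (linComb x M))) F
  finrank_le : Module.finrank (IntermediateField.adjoin L (Set.range (linComb x M))) F ≤ D
  exists_point : ∃ h : MvPolynomial (Fin d) L, h ≠ 0 ∧ ∀ b, eval b h ≠ 0 →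
    ∃ y ∈ V, linComb y M = b

open scoped IntermediateField.algebraAdjoinAdjoin in
/-- If the components of a linear map are a separating transcendence basis of the function field of
`V`, then a general fibre of the map has at least as many points on `V` as the degree of the
function field over the subfield generated by the components. -/
theorem finrank_le_encard_inter_linearVariety {L F : Type u} [Field L] [IsAlgClosed L] [Field F]
    [Algebra L F] [Algebra.EssFiniteType L F] {n d : ℕ} {V : Set (Fin n → L)} (hV : IsVariety V)
    {x : Fin n → F} (hx : IsGenericPoint V x)
    (hgen : IntermediateField.adjoin L (Set.range x) = ⊤) (M : Fin d → Fin n → L)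
    [Algebra.IsSeparable (IntermediateField.adjoin L (Set.range (linComb x M))) F]
    [FiniteDimensional (IntermediateField.adjoin L (Set.range (linComb x M))) F]
    (hM : AlgebraicIndependent L (linComb x M)) :
    ∃ h : MvPolynomial (Fin d) L, h ≠ 0 ∧ ∀ b, eval b h ≠ 0 →
      (Module.finrank (IntermediateField.adjoin L (Set.range (linComb x M))) F : ℕ∞) ≤
        (V ∩ linearVariety M b).encard := by
  set E := IntermediateField.adjoin L (Set.range (linComb x M))
  let P := Algebra.adjoin L (Set.range (linComb x M))
  have hadj : Algebra.adjoin E (Set.range x) = ⊤ := by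
    rw [← IntermediateField.adjoin_toSubalgebra_of_isAlgebraic
      fun z _ => Algebra.IsAlgebraic.isAlgebraic z]
    have : IntermediateField.adjoin E (Set.range x) = ⊤ := by
      rw [eq_top_iff]
      intro z _
      have hz : z ∈ IntermediateField.adjoin L (Set.range x) := hgen ▸ IntermediateField.mem_top
      have hle : IntermediateField.adjoin L (Set.range x) ≤
          (IntermediateField.adjoin E (Set.range x)).restrictScalars L :=
        IntermediateField.adjoin_le_iff.mpr (IntermediateField.subset_adjoin E _)
      exact hle hz
    rw [this, IntermediateField.top_toSubalgebra]
  obtain ⟨h, hh0, hh⟩ := exists_forall_finrank_le_encard.{u} (P := P) (E := E) x hadj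
  refine ⟨hM.aevalEquiv.symm h, by simpa using hh0, fun b hb => ?_⟩
  let χ : P →+* L := (eval b).comp (hM.aevalEquiv.symm : P →+* MvPolynomial (Fin d) L)
  have hχ : χ h ≠ 0 := hb
  refine (hh χ hχ).trans (Set.encard_le_encard fun y hy => ⟨?_, fun i => ?_⟩)
  · rw [← zeroLocus_vanishingIdeal hV]
    intro q hq
    have h0 : aeval x q = 0 := (hx q).mpr hq
    have h1 := hy (map (algebraMap L P) q) (by
      rw [eval₂_map, ← h0, aeval_def]
      rfl)
    rw [eval₂_map] at h1
    rw [← h1, aeval_def]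
    congr 1
    ext c
    have : hM.aevalEquiv.symm (algebraMap L P c) = C c := by
      rw [AlgEquiv.commutes]; rfl
    simp [χ, this]
  · have hmem : linComb x M i ∈ P := Algebra.subset_adjoin ⟨i, rfl⟩
    have h1 := hy (∑ j, C (algebraMap L P (M i j)) * X j - C ⟨linComb x M i, hmem⟩) (by
      rw [eval₂_sub, eval₂_sum, eval₂_C, sub_eq_zero]
      simp only [eval₂_mul, eval₂_C, eval₂_X]
      change _ = linComb x M i
      refine Finset.sum_congr rfl fun j _ => ?_
      rw [Algebra.smul_def]
      rfl)
    rw [eval₂_sub, eval₂_sum, eval₂_C, sub_eq_zero] at h1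
    simp only [eval₂_mul, eval₂_C, eval₂_X] at h1
    have e1 : χ ⟨linComb x M i, hmem⟩ = b i := by
      have : hM.aevalEquiv.symm ⟨linComb x M i, hmem⟩ = X i := by
        rw [AlgEquiv.symm_apply_eq]
        ext
        simp
      simp [χ, this]
    have e2 : ∀ c, χ (algebraMap L P c) = c := by
      intro c
      have : hM.aevalEquiv.symm (algebraMap L P c) = C c := by
        rw [AlgEquiv.commutes]; rfl
      simp [χ, this]
    rw [e1] at h1
    simpa only [e2] using h1

/-- A nonzero polynomial over an extension of an infinite field `L` is nonzero at some point with
coordinates in `L`. -/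
theorem exists_eval_algebraMap_ne_zero {L F : Type*} [Field L] [Infinite L] [Field F] [Algebra L F]
    {σ : Type*} {R : MvPolynomial σ F} (hR : R ≠ 0) :
    ∃ M : σ → L, eval (fun s => algebraMap L F (M s)) R ≠ 0 := by
  by_contra! h
  refine hR (funext_set (fun _ => Set.range (algebraMap L F))
    (fun _ => Set.infinite_range_of_injective (algebraMap L F).injective) fun z hz => ?_)
  choose M hM using fun s => hz s (Set.mem_univ s)
  rw [map_zero, ← h M]
  congr 2
  ext s
  exact (hM s).symm

/-- **A general projection is good**, for the degree of `V` as degree bound: a general fibre has at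
least as many points on `V` as the degree of the field extension, and a general linear variety of
codimension `d`, which is such a fibre, has exactly `D`. -/
theorem exists_mvPolynomial_isGoodProjection {L F : Type u} [Field L] [IsAlgClosed L] [Field F]
    [Algebra L F] [Algebra.EssFiniteType L F] {n d D : ℕ} {V : Set (Fin n → L)}
    (hV : IsVariety V) (hdim : dim V = d) (hdeg : HasDegree V D) {x : Fin n → F}
    (hx : IsGenericPoint V x) (hgen : IntermediateField.adjoin L (Set.range x) = ⊤)
    (hd : Algebra.trdeg L F = d) :
    ∃ R : MvPolynomial (Fin d × Fin n) F, R ≠ 0 ∧ ∀ M : Fin d → Fin n → L,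
      eval (fun p => algebraMap L F (M p.1 p.2)) R ≠ 0 → IsGoodProjection V x D M := by
  obtain ⟨d', hd', Q, hQ0, hQ⟩ := hdeg
  obtain rfl : d' = d := by
    rw [hdim] at hd'
    exact_mod_cast hd'.symm
  obtain ⟨R, hR0, hR⟩ := exists_mvPolynomial_isSeparable hd x hgen
  obtain ⟨z, hz⟩ := exists_eval_algebraMap_ne_zero (L := L) hQ0
  -- The condition on `M` that `Q(M, ·)` be nonzero, witnessed by its value at a fixed point `b₁`.
  let b₁ : Fin d' → L := fun i => z (Sum.inr i)
  let Q₁ : MvPolynomial (Fin d' × Fin n) L := bind₁ (Sum.elim X fun i => C (b₁ i)) Q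
  have hQ₁ : ∀ M : Fin d' → Fin n → L, eval (fun p => M p.1 p.2) Q₁ =
      eval (Sum.elim (fun p => M p.1 p.2) b₁) Q := by
    intro M
    rw [eval, eval₂Hom_bind₁]
    congr 2
    ext (p | i)
    · simp
    · simp
  have hQ₁0 : Q₁ ≠ 0 := by
    intro h
    have := hQ₁ (fun i j => z (Sum.inl (i, j)))
    rw [h, map_zero] at this
    refine hz ?_
    rw [this]
    simp only [Algebra.algebraMap_self, RingHom.id_apply]
    congr 2
    ext (p | i) <;> rfl
  refine ⟨R * map (algebraMap L F) Q₁, mul_ne_zero hR0 ?_, fun M hM => ?_⟩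
  · rwa [Ne, map_eq_zero_iff _ (map_injective _ (algebraMap L F).injective)]
  rw [map_mul] at hM
  obtain ⟨hsep, hind⟩ := hR M (left_ne_zero_of_mul hM)
  have hQM : eval (Sum.elim (fun p => M p.1 p.2) b₁) Q ≠ 0 := by
    have := right_ne_zero_of_mul hM
    rw [eval_map, ← hQ₁] at *
    intro h0
    apply this
    have e := eval₂_comp_left (algebraMap L F) (RingHom.id L) (fun p : Fin d' × Fin n => M p.1 p.2)
      Q₁
    rw [RingHom.comp_id] at e
    change eval₂ _ (algebraMap L F ∘ fun p : Fin d' × Fin n => M p.1 p.2) Q₁ = 0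
    rw [← e]
    change algebraMap L F (eval (fun p => M p.1 p.2) Q₁) = 0
    rw [h0, map_zero]
  set E := IntermediateField.adjoin L (Set.range (linComb x M))
  have : Algebra.EssFiniteType E F := Algebra.EssFiniteType.of_comp L E F
  have : Algebra.FormallyUnramified E F := Algebra.FormallyUnramified.of_isSeparable E F
  have hfin : FiniteDimensional E F := Algebra.FormallyUnramified.finite_of_free E F
  obtain ⟨h, hh0, hh⟩ := finrank_le_encard_inter_linearVariety hV hx hgen M hind
  let Q₂ : MvPolynomial (Fin d') L := bind₁ (Sum.elim (fun p => C (M p.1 p.2)) X) Q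
  have hQ₂ : ∀ b, eval b Q₂ = eval (Sum.elim (fun p => M p.1 p.2) b) Q := by
    intro b
    rw [eval, eval₂Hom_bind₁]
    congr 2
    ext (p | i)
    · simp
    · simp
  have hQ₂0 : Q₂ ≠ 0 := by
    intro h
    rw [← hQ₂, h, map_zero] at hQM
    exact hQM rfl
  refine ⟨hind, hfin, ?_, h, hh0, fun b hb => ?_⟩
  · obtain ⟨b, hb⟩ := exists_eval_algebraMap_ne_zero (L := L) (mul_ne_zero hh0 hQ₂0)
    rw [map_mul] at hb
    have h1 := hh _ (left_ne_zero_of_mul hb)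
    rw [hQ M _ (by rw [← hQ₂]; exact right_ne_zero_of_mul hb)] at h1
    exact_mod_cast h1
  · have h1 := hh b hb
    have h2 : (1 : ℕ∞) ≤ Module.finrank E F := by
      exact_mod_cast Module.finrank_pos
    obtain ⟨y, hyV, hy⟩ := Set.one_le_encard_iff_nonempty.mp (h2.trans h1)
    exact ⟨y, hyV, _root_.funext hy⟩

end Escape

/-! ### Degrees of relations between linear forms -/

namespace Escape

open MvPolynomial

section Relations

variable {L F : Type u} [Field L] [Field F] [Algebra L F]

/-- A relation of minimal degree exists as soon as there are more elements than the transcendence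
degree. -/
theorem exists_minimal_relation {d : ℕ} (hd : Algebra.trdeg L F = d) (l : Fin (d + 1) → F) :
    ∃ f : MvPolynomial (Fin (d + 1)) L, f ≠ 0 ∧ aeval l f = 0 ∧
      ∀ g : MvPolynomial (Fin (d + 1)) L, g ≠ 0 → aeval l g = 0 →
        f.totalDegree ≤ g.totalDegree := by
  have hne : {f : MvPolynomial (Fin (d + 1)) L | f ≠ 0 ∧ aeval l f = 0}.Nonempty := by
    by_contra h
    have hind : AlgebraicIndependent L l := by
      rw [algebraicIndependent_iff]
      intro f hf
      by_contra hf0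
      exact h ⟨f, hf0, hf⟩
    have h1 := hind.lift_cardinalMk_le_trdeg
    rw [hd] at h1
    simp only [Cardinal.mk_fin, Cardinal.lift_natCast] at h1
    have h2 : d + 1 ≤ d := by exact_mod_cast h1
    omega
  exact ⟨totalDegree.argminOn _ hne, (totalDegree.argminOn_mem _ hne).1,
    (totalDegree.argminOn_mem _ hne).2, fun g h1 h2 => totalDegree.argminOn_le
      {f : MvPolynomial (Fin (d + 1)) L | f ≠ 0 ∧ aeval l f = 0} ⟨h1, h2⟩⟩

open scoped IntermediateField.algebraAdjoinAdjoin in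
/-- The degree in the `j`-th variable of an irreducible relation of `l` is at most the degree of `F`
over the subfield generated by the other elements, if these are algebraically independent: by
Gauss's lemma the relation is then irreducible over this subfield, hence a multiple of a minimal
polynomial. -/
theorem degreeOf_le_finrank {ι : Type*} [Finite ι] {l : ι → F} {f : MvPolynomial ι L}
    (hf : Irreducible f) (hfl : aeval l f = 0) (j : ι)
    (hind : AlgebraicIndependent L fun i : {i | i ≠ j} => l i)
    [FiniteDimensional (IntermediateField.adjoin L (l '' {j}ᶜ)) F] :
    f.degreeOf j ≤ Module.finrank (IntermediateField.adjoin L (l '' {j}ᶜ)) F := by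
  classical
  have hUFD := (AlgebraicIndepOn.aevalEquiv (s := {j}ᶜ) hind).uniqueFactorizationMonoid
    inferInstance
  have hirr := irreducible_toPolynomialAdjoinImageCompl hf j hind
  have hroot : Polynomial.aeval (l j) (toPolynomialAdjoinImageCompl f l j) = 0 :=
    aeval_toPolynomialAdjoinImageCompl_eq_zero hfl j
  have hdeg : (toPolynomialAdjoinImageCompl f l j).natDegree = f.degreeOf j := by
    let φ : MvPolynomial {i // i ≠ j} L →ₐ[L] Algebra.adjoin L (l '' {j}ᶜ) :=
      aeval fun i => ⟨l i, Algebra.subset_adjoin ⟨i, i.2, rfl⟩⟩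
    have hinj : Function.Injective φ := by
      refine (injective_iff_map_eq_zero _).mpr fun q hq => ?_
      refine (injective_iff_map_eq_zero _).mp hind q ?_
      have := congrArg (Subalgebra.val _) hq
      rw [map_zero, ← AlgHom.comp_apply, comp_aeval] at this
      exact this
    rw [degreeOf_eq_natDegree, toPolynomialAdjoinImageCompl, Polynomial.coe_mapAlgHom,
      Polynomial.natDegree_map_eq_of_injective ?_, renameEquiv_apply]
    · congr!
    · exact hinj
  rw [← hdeg]
  by_cases h0 : (toPolynomialAdjoinImageCompl f l j).natDegree = 0
  · rw [h0]
    exact Nat.zero_le _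
  have hirr' := (hirr.isPrimitive h0).irreducible_iff_irreducible_map_fraction_map
    (K := IntermediateField.adjoin L (l '' {j}ᶜ)) |>.mp hirr
  have hmin := minpoly.eq_of_irreducible hirr'
    ((Polynomial.aeval_map_algebraMap ..).trans hroot)
  have h1 := minpoly.natDegree_le (A := IntermediateField.adjoin L (l '' {j}ᶜ)) (l j)
  rw [← hmin, Polynomial.natDegree_mul_C (by simpa using hirr'.ne_zero),
    Polynomial.natDegree_map_eq_of_injective (FaithfulSMul.algebraMap_injective _ _)] at h1
  exact h1

end Relations

/-- `d + 1` linear forms, any `d` of which form a good projection, satisfy a relation of bounded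
degree: a relation of minimal degree is irreducible, so its degree in each variable is at most
`D`. -/
theorem exists_relation_of_isGoodProjection {L F : Type u} [Field L] [Field F] [Algebra L F]
    {n d D : ℕ} {V : Set (Fin n → L)} {x : Fin n → F} (hd : Algebra.trdeg L F = d)
    (M : Fin (d + 1) → Fin n → L)
    (hM : ∀ j : Fin (d + 1), IsGoodProjection V x D (M ∘ j.succAbove)) :
    ∃ f : MvPolynomial (Fin (d + 1)) L, f ≠ 0 ∧ f.totalDegree ≤ (d + 1) * D ∧
      aeval (linComb x M) f = 0 := by
  classical
  obtain ⟨f, hf0, hf, hmin⟩ := exists_minimal_relation hd (linComb x M)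
  have hirr := irreducible_of_forall_totalDegree_le hmin hf0 hf
  refine ⟨f, hf0, ?_, hf⟩
  have hdeg : ∀ j, f.degreeOf j ≤ D := by
    intro j
    obtain ⟨h1, h2, h3, -⟩ := hM j
    have hrange : linComb x M '' {j}ᶜ = Set.range (linComb x (M ∘ j.succAbove)) := by
      rw [← Fin.range_succAbove j, ← Set.range_comp]
      rfl
    have hind : AlgebraicIndependent L fun i : {i | i ≠ j} => linComb x M i := by
      have := h1.comp (finSuccAboveEquiv j).symm (Equiv.injective _)
      convert! this using 1
      ext i
      have e := congrArg Subtype.val ((finSuccAboveEquiv j).apply_symm_apply i)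
      rw [finSuccAboveEquiv_apply] at e
      conv_lhs => rw [← e]
      rfl
    rw [← hrange] at h2 h3
    exact (degreeOf_le_finrank hirr hf j hind).trans h3
  refine Finset.sup_le fun s hs => ?_
  rw [Finsupp.sum_fintype _ _ (fun _ => rfl)]
  refine (Finset.sum_le_sum fun j _ => (degreeOf_le_iff.mp (hdeg j)) s hs).trans ?_
  simp

end Escape

/-! ### Relations of bounded degree and the linear span of a variety -/

namespace Escape

open MvPolynomial

/-- A linear functional, applied to the value of a polynomial with coefficients in `F` at points
with coordinates in `L`, is a polynomial function with coefficients in `L`. -/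
theorem exists_eval_eq_apply_eval {L F : Type*} [Field L] [Field F] [Algebra L F] {σ : Type*}
    (φ : F →ₗ[L] L) (p : MvPolynomial σ F) : ∃ p' : MvPolynomial σ L, ∀ M : σ → L,
      eval M p' = φ (eval (fun s => algebraMap L F (M s)) p) := by
  refine ⟨∑ u ∈ p.support, monomial u (φ (coeff u p)), fun M => ?_⟩
  rw [map_sum, eval_eq, map_sum]
  refine Finset.sum_congr rfl fun u _ => ?_
  rw [eval_monomial, Finsupp.prod, mul_comm (coeff u p)]
  simp_rw [← map_pow, ← map_prod]
  rw [← Algebra.smul_def, map_smul, smul_eq_mul, mul_comm]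

/-- **Relations of bounded degree are a closed condition.** If general linear forms satisfy a
relation of degree at most `m`, then so do all: linear independence of the monomials of degree at
most `m` at one point is witnessed by a nonvanishing determinant, which does not vanish at general
points either. -/
theorem exists_relation_of_general {L F : Type u} [Field L] [Infinite L] [Field F] [Algebra L F]
    {κ : Type} [Finite κ] {n m : ℕ} (x : Fin n → F) {R : MvPolynomial (κ × Fin n) F} (hR0 : R ≠ 0)
    (hR : ∀ M : κ → Fin n → L, eval (fun p => algebraMap L F (M p.1 p.2)) R ≠ 0 →
      ∃ f : MvPolynomial κ L, f ≠ 0 ∧ f.totalDegree ≤ m ∧ aeval (linComb x M) f = 0)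
    (M : κ → Fin n → L) :
    ∃ f : MvPolynomial κ L, f ≠ 0 ∧ f.totalDegree ≤ m ∧ aeval (linComb x M) f = 0 := by
  classical
  by_contra hcon
  let H := restrictTotalDegree κ L m
  let T : (κ → Fin n → L) → H →ₗ[L] F := fun M => (aeval (linComb x M)).toLinearMap ∘ₗ H.subtype
  have hT : ∀ M (f : H), T M f = aeval (linComb x M) f.1 := fun _ _ => rfl
  have hker : LinearMap.ker (T M) = ⊥ := by
    refine (Submodule.eq_bot_iff _).mpr fun f hf => ?_
    by_contra hf0
    refine hcon ⟨f.1, fun h => hf0 (Subtype.ext h), (mem_restrictTotalDegree _ _ _).mp f.2, ?_⟩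
    rwa [LinearMap.mem_ker, hT] at hf
  obtain ⟨π, hπ⟩ := (T M).exists_leftInverse_of_injective hker
  let b := Module.finBasis L H
  -- The matrix of `π ∘ T M'`, with entries polynomial in `M'`.
  have hA : ∀ s t, ∃ p : MvPolynomial (κ × Fin n) L, ∀ M' : κ × Fin n → L,
      eval M' p = b.repr (π (T (fun i j => M' (i, j)) (b t))) s := by
    intro s t
    obtain ⟨p, hp⟩ := exists_eval_eq_apply_eval (σ := κ × Fin n) (b.coord s ∘ₗ π)
      (aeval (fun i => ∑ j, X (i, j) * C (x j)) (b t).1)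
    refine ⟨p, fun M' => ?_⟩
    rw [hp, LinearMap.comp_apply, Module.Basis.coord_apply, hT]
    congr 3
    let ev : MvPolynomial (κ × Fin n) F →ₐ[L] F :=
      (aeval (R := F) fun s => algebraMap L F (M' s)).restrictScalars L
    have h1 : ∀ q, ev q = eval (fun s => algebraMap L F (M' s)) q := fun q => by
      simp [ev, aeval_eq_eval]
    rw [← h1, ← AlgHom.comp_apply, comp_aeval]
    congr 2
    ext i
    rw [h1]
    simp [linComb, Algebra.smul_def]
  choose A hA using hA
  have hdet : ∀ M' : κ → Fin n → L, eval (fun p => M' p.1 p.2) (Matrix.det (Matrix.of A)) =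
      LinearMap.det (π ∘ₗ T M') := by
    intro M'
    rw [← LinearMap.det_toMatrix b, RingHom.map_det]
    congr 1
    ext s t
    simp [hA, LinearMap.toMatrix_apply]
  have hdet0 : Matrix.det (Matrix.of A) ≠ 0 := by
    intro h
    have h1 := hdet M
    rw [h, hπ, map_zero, LinearMap.det_id] at h1
    exact zero_ne_one h1
  obtain ⟨M', hM'⟩ := exists_eval_algebraMap_ne_zero (L := L) (mul_ne_zero hR0
    ((map_eq_zero_iff _ (map_injective _ (algebraMap L F).injective)).not.mpr hdet0))
  rw [map_mul] at hM'
  obtain ⟨f, hf0, hfm, hf⟩ := hR (fun i j => M' (i, j)) (left_ne_zero_of_mul hM')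
  have hdetM : LinearMap.det (π ∘ₗ T fun i j => M' (i, j)) ≠ 0 := by
    rw [← hdet]
    intro h0
    apply right_ne_zero_of_mul hM'
    rw [eval_map]
    have e := eval₂_comp_left (algebraMap L F) (RingHom.id L) M' (Matrix.det (Matrix.of A))
    rw [RingHom.comp_id] at e
    change eval₂ _ (algebraMap L F ∘ M') _ = 0
    rw [← e]
    change algebraMap L F (eval M' _) = 0
    rw [h0, map_zero]
  have hinj := LinearMap.ker_eq_bot.mpr (LinearEquiv.ofIsUnitDet
    (v := b) (v' := b) (f := π ∘ₗ T fun i j => M' (i, j)) (by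
      rw [LinearMap.det_toMatrix]; exact hdetM.isUnit)).injective
  have hmem : (⟨f, (mem_restrictTotalDegree _ _ _).mpr hfm⟩ : H) ∈
      LinearMap.ker (π ∘ₗ T fun i j => M' (i, j)) := by
    rw [LinearMap.mem_ker, LinearMap.comp_apply, hT, hf, map_zero]
  have h0 : (⟨f, (mem_restrictTotalDegree _ _ _).mpr hfm⟩ : H) = 0 := by
    rw [← Submodule.mem_bot L, ← hinj]
    exact hmem
  exact hf0 (congrArg Subtype.val h0)

/-- **Any `d + 1` linear forms on `V` satisfy a relation of bounded degree**, where `d` is the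
dimension. -/
theorem exists_relation_totalDegree_le {L F : Type u} [Field L] [IsAlgClosed L] [Field F]
    [Algebra L F] [Algebra.EssFiniteType L F] {n d D : ℕ} {V : Set (Fin n → L)}
    (hV : IsVariety V) (hdim : dim V = d) (hdeg : HasDegree V D) {x : Fin n → F}
    (hx : IsGenericPoint V x) (hgen : IntermediateField.adjoin L (Set.range x) = ⊤)
    (hd : Algebra.trdeg L F = d) (M : Fin (d + 1) → Fin n → L) :
    ∃ f : MvPolynomial (Fin (d + 1)) L, f ≠ 0 ∧ f.totalDegree ≤ (d + 1) * D ∧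
      aeval (linComb x M) f = 0 := by
  obtain ⟨R, hR0, hR⟩ := exists_mvPolynomial_isGoodProjection hV hdim hdeg hx hgen hd
  -- Any `d` of the `d + 1` forms have to be general.
  let ι : Fin (d + 1) → Fin d × Fin n → Fin (d + 1) × Fin n := fun j p => (j.succAbove p.1, p.2)
  have hι : ∀ j, Function.Injective (ι j) := by
    rintro j ⟨p1, p2⟩ ⟨q1, q2⟩ h
    simp only [ι, Prod.mk.injEq, Fin.succAbove_right_inj] at h
    rw [h.1, h.2]
  refine exists_relation_of_general x (R := ∏ j, rename (ι j) R) ?_ (fun M hM => ?_) M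
  · exact Finset.prod_ne_zero_iff.mpr fun j _ =>
      (map_eq_zero_iff _ (rename_injective _ (hι j))).not.mpr hR0
  · refine exists_relation_of_isGoodProjection (V := V) hd M fun j => hR _ ?_
    rw [map_prod] at hM
    have := Finset.prod_ne_zero_iff.mp hM j (Finset.mem_univ j)
    rwa [eval_rename] at this

/-- Finitely many points of the complement of a hypersurface suffice to detect polynomials of
degree at most `m`. -/
theorem exists_finset_eval_eq_zero {L : Type*} [Field L] [Infinite L] {d : ℕ} (m : ℕ)
    {h : MvPolynomial (Fin d) L} (hh : h ≠ 0) :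
    ∃ B : Finset (Fin d → L), B.card ≤ monomialCount d m ∧ (∀ b ∈ B, eval b h ≠ 0) ∧
      ∀ f : MvPolynomial (Fin d) L, f.totalDegree ≤ m → (∀ b ∈ B, eval b f = 0) → f = 0 := by
  classical
  let H := restrictTotalDegree (Fin d) L m
  let ev : (Fin d → L) → Module.Dual L H := fun b => (aeval b).toLinearMap ∘ₗ H.subtype
  have hev : ∀ b (f : H), ev b f = eval b f.1 := fun b f => by simp [ev, aeval_eq_eval]
  obtain ⟨t, htX, htcard, htspan, -⟩ :=
    Submodule.exists_finset_span_eq_linearIndepOn L (ev '' {b | eval b h ≠ 0})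
  have hpt : ∀ φ ∈ t, ∃ b, eval b h ≠ 0 ∧ ev b = φ := fun φ hφ => htX hφ
  choose! p hp hpev using hpt
  refine ⟨t.image p, ?_, ?_, fun f hf hfB => ?_⟩
  · refine Finset.card_image_le.trans ?_
    rw [htcard, ← finrank_restrictTotalDegree L, ← Subspace.dual_finrank_eq]
    exact Submodule.finrank_le _
  · intro b hb
    obtain ⟨φ, hφ, rfl⟩ := Finset.mem_image.mp hb
    exact hp φ hφ
  · let f' : H := ⟨f, (mem_restrictTotalDegree _ _ _).mpr hf⟩
    have hle : Submodule.span L (ev '' {b | eval b h ≠ 0}) ≤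
        LinearMap.ker (Module.Dual.eval L H f') := by
      rw [← htspan, Submodule.span_le]
      intro φ hφ
      rw [SetLike.mem_coe, LinearMap.mem_ker, Module.Dual.eval_apply, ← hpev φ hφ, hev]
      exact hfB _ (Finset.mem_image_of_mem p hφ)
    have hfh : f * h = 0 := by
      refine funext fun b => ?_
      rw [map_mul, map_zero]
      by_cases hb : eval b h = 0
      · rw [hb, mul_zero]
      · have h1 := hle (Submodule.subset_span ⟨b, hb, rfl⟩)
        rw [LinearMap.mem_ker, Module.Dual.eval_apply, hev] at h1
        rw [h1, zero_mul]
    exact (mul_eq_zero.mp hfh).resolve_right hh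

/-- **A variety of bounded dimension and degree spans a subspace of bounded dimension.** The span is
generated by points of `V` over a finite set of values of a good projection that detects
polynomials of bounded degree: if a linear form `ξ` vanishes at these points, then in a minimal
relation between `ξ` and the components of the projection the terms without `ξ` vanish, so it is
divisible by `ξ`, and `ξ` is zero on `V`. -/
theorem exists_submodule_finrank_le {L : Type u} [Field L] [IsAlgClosed L] {n d D : ℕ}
    {V : Set (Fin n → L)} (hV : IsIrreducibleVariety V) (hdim : dim V = d)
    (hdeg : HasDegree V D) :
    ∃ U : Submodule L (Fin n → L), Module.finrank L U ≤ monomialCount d ((d + 1) * D) ∧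
      V ⊆ U := by
  classical
  obtain ⟨F, _, _, _, x, hx, hgen, hd⟩ := exists_isGenericPoint hV hdim
  obtain ⟨R, hR0, hR⟩ := exists_mvPolynomial_isGoodProjection hV.1 hdim hdeg hx hgen hd
  obtain ⟨M', hM'⟩ := exists_eval_algebraMap_ne_zero (L := L) hR0
  set M : Fin d → Fin n → L := fun i j => M' (i, j)
  obtain ⟨-, -, -, h, hh0, hpt⟩ := hR M hM'
  obtain ⟨B, hBcard, hBh, hB⟩ := exists_finset_eval_eq_zero ((d + 1) * D) hh0
  choose! p hpV hp using hpt
  refine ⟨Submodule.span L (B.image p : Set (Fin n → L)),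
    (finrank_span_finset_le_card _).trans (Finset.card_image_le.trans hBcard), fun y hy => ?_⟩
  by_contra hyU
  -- A linear form `c` that vanishes on the span, but not at `y`.
  obtain ⟨c, hcy, hcU⟩ := Submodule.exists_le_ker_of_notMem hyU
  -- The linear form `c` as a row of coefficients, put in front of `M`.
  let N : Fin (d + 1) → Fin n → L := Fin.cons (fun j => c (Pi.single j 1)) M
  have hN0 : ∀ y : Fin n → L, linComb y N 0 = c y := by
    intro y
    conv_rhs => rw [pi_eq_sum_univ' y, map_sum]
    simp [linComb, N, mul_comm]
  have hNs : ∀ (y : Fin n → L) i, linComb y N (Fin.succ i) = linComb y M i := fun _ _ => rfl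
  have hξ : linComb x N 0 ≠ 0 := by
    intro h0
    have h1 : aeval (linComb x N) (X 0 : MvPolynomial (Fin (d + 1)) L) = 0 := by
      rw [aeval_X, h0]
    rw [hx.aeval_linComb] at h1
    have h2 := h1 y hy
    rw [aeval_X, hN0] at h2
    exact hcy h2
  obtain ⟨g, hg0, hgdeg, hg⟩ := exists_relation_totalDegree_le hV.1 hdim hdeg hx hgen hd N
  obtain ⟨f, hf0, hf, hmin⟩ := exists_minimal_relation hd (linComb x N)
  have hfdeg := (hmin g hg0 hg).trans hgdeg
  -- The part of `f` without the variable `X 0` vanishes at the points of `B`.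
  have hcoeff : (finSuccEquiv L d f).coeff 0 = 0 := by
    by_contra hne
    refine hne (hB _ ?_ fun b hb => ?_)
    · have := totalDegree_coeff_finSuccEquiv_add_le f 0 hne
      omega
    · have h1 := (hx.aeval_linComb N f).mp hf (p b) (hpV b (hBh b hb))
      have h2 : linComb (p b) N = Fin.cons 0 b := by
        ext i
        refine Fin.cases ?_ (fun i => ?_) i
        · rw [hN0, Fin.cons_zero]
          exact hcU (Submodule.subset_span (Finset.mem_coe.mpr (Finset.mem_image_of_mem p hb)))
        · rw [hNs, hp b (hBh b hb), Fin.cons_succ]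
      rw [h2, aeval_eq_eval] at h1
      change eval _ f = 0 at h1
      rw [eval_eq_eval_mv_eval', ← Polynomial.coeff_zero_eq_eval_zero, Polynomial.coeff_map] at h1
      exact h1
  obtain ⟨q, hq⟩ := Polynomial.X_dvd_iff.mpr hcoeff
  have hfq : f = X 0 * (finSuccEquiv L d).symm q := by
    apply (finSuccEquiv L d).injective
    rw [map_mul, finSuccEquiv_X_zero, AlgEquiv.apply_symm_apply, hq]
  have hq0 : (finSuccEquiv L d).symm q ≠ 0 := by
    rintro h0
    rw [h0, mul_zero] at hfq
    exact hf0 hfq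
  have hqrel : aeval (linComb x N) ((finSuccEquiv L d).symm q) = 0 := by
    rw [hfq, map_mul, aeval_X] at hf
    exact (mul_eq_zero.mp hf).resolve_left hξ
  have h1 := hmin _ hq0 hqrel
  rw [hfq, totalDegree_mul_of_isDomain (X_ne_zero 0) hq0, totalDegree_X] at h1
  omega

end Escape

/-! ### Linear projections that do not decrease valuations -/

namespace Escape

open MvPolynomial

theorem aeval_mul_left_of_isHomogeneous {R S σ : Type*} [CommSemiring R] [CommSemiring S]
    [Algebra R S] {g : MvPolynomial σ R} {r : ℕ} (hg : g.IsHomogeneous r) (c : S) (z : σ → S) :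
    aeval (fun i => c * z i) g = c ^ r * aeval z g := by
  rw [aeval_def, aeval_def, eval₂_eq, eval₂_eq, Finset.mul_sum]
  refine Finset.sum_congr rfl fun s hs => ?_
  have h : ∑ i ∈ s.support, s i = r := by
    rw [← hg (mem_support_iff.mp hs), Finsupp.weight_apply, Finsupp.sum]
    simp
  simp_rw [mul_pow]
  rw [Finset.prod_mul_distrib, Finset.prod_pow_eq_pow_sum, h]
  ring

/-- More elements than the transcendence degree plus one satisfy a homogeneous relation: their
multiples by a variable are algebraically dependent. -/
theorem exists_isHomogeneous_relation {L F : Type u} [Field L] [Field F] [Algebra L F] {d m : ℕ}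
    (hd : Algebra.trdeg L F = d) (hm : d + 1 < m) (z : Fin m → F) :
    ∃ (r : ℕ) (g : MvPolynomial (Fin m) L), g.IsHomogeneous r ∧ g ≠ 0 ∧ aeval z g = 0 := by
  have hdep : ¬ AlgebraicIndependent L
      fun i => (Polynomial.X * Polynomial.C (z i) : Polynomial F) := by
    intro h
    have h1 := h.lift_cardinalMk_le_trdeg
    rw [← trdeg_add_eq L F (A := Polynomial F), Polynomial.trdeg_of_isDomain, hd] at h1
    simp only [Cardinal.mk_fin, Cardinal.lift_natCast, Cardinal.lift_add, Cardinal.lift_one] at h1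
    have h2 : m ≤ d + 1 := by exact_mod_cast h1
    omega
  rw [algebraicIndependent_iff] at hdep
  push Not at hdep
  obtain ⟨p, hp, hp0⟩ := hdep
  obtain ⟨r, hr⟩ : ∃ r, homogeneousComponent r p ≠ 0 := by
    by_contra! h
    refine hp0 ?_
    rw [← sum_homogeneousComponent p]
    exact Finset.sum_eq_zero fun r _ => h r
  refine ⟨r, homogeneousComponent r p, homogeneousComponent_isHomogeneous r p, hr, ?_⟩
  by_cases hrp : p.totalDegree < r
  · exact absurd (homogeneousComponent_eq_zero r p hrp) hr
  rw [← sum_homogeneousComponent p, map_sum] at hp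
  have h1 : ∀ s, aeval (fun i => (Polynomial.X * Polynomial.C (z i) : Polynomial F))
      (homogeneousComponent s p) =
      Polynomial.X ^ s * Polynomial.C (aeval z (homogeneousComponent s p)) := by
    intro s
    rw [aeval_mul_left_of_isHomogeneous (homogeneousComponent_isHomogeneous s p)]
    congr 1
    exact (comp_aeval_apply z (Polynomial.CAlgHom (R := L) (A := F)) _).symm
  have h2 := congrArg (fun q => Polynomial.coeff q r) hp
  simp only [h1, Polynomial.finsetSum_coeff, Polynomial.coeff_zero] at h2
  rw [Finset.sum_eq_single_of_mem r (by simp; omega)] at h2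
  · rwa [mul_comm, Polynomial.coeff_C_mul_X_pow, if_pos rfl] at h2
  · intro s _ hs
    rw [mul_comm, Polynomial.coeff_C_mul_X_pow, if_neg (Ne.symm hs)]

section Valuation

variable {L F : Type*} [Field L] [Field F] [Algebra L F] {O : ValuationSubring F}

theorem valuation_algebraMap_eq_one (hO : ∀ c : L, algebraMap L F c ∈ O) {c : L} (hc : c ≠ 0) :
    O.valuation (algebraMap L F c) = 1 := by
  have h1 := (O.valuation_le_one_iff _).mpr (hO c)
  have h2 := (O.valuation_le_one_iff _).mpr (hO c⁻¹)
  have h3 : O.valuation (algebraMap L F c) * O.valuation (algebraMap L F c⁻¹) = 1 := by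
    rw [← map_mul, ← map_mul, mul_inv_cancel₀ hc, map_one, map_one]
  refine le_antisymm h1 ?_
  calc 1 = O.valuation (algebraMap L F c) * O.valuation (algebraMap L F c⁻¹) := h3.symm
    _ ≤ O.valuation (algebraMap L F c) * 1 := by gcongr
    _ = _ := mul_one _

/-- Polynomials over `L` respect congruences modulo the maximal ideal of a valuation ring. -/
theorem valuation_aeval_sub_lt_one (hO : ∀ c : L, algebraMap L F c ∈ O) {σ : Type*} {u : σ → F}
    {w : σ → L} (h : ∀ i, O.valuation (u i - algebraMap L F (w i)) < 1) (g : MvPolynomial σ L) :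
    O.valuation (aeval u g - algebraMap L F (eval w g)) < 1 := by
  induction g using MvPolynomial.induction_on with
  | C a => simp
  | add p q hp hq =>
    rw [map_add, map_add, map_add, add_sub_add_comm]
    exact O.valuation.map_add_lt hp hq
  | mul_X p i hp =>
    have hu : O.valuation (u i) ≤ 1 := by
      rw [← sub_add_cancel (u i) (algebraMap L F (w i))]
      exact O.valuation.map_add_le (h i).le ((O.valuation_le_one_iff _).mpr (hO _))
    have e : aeval u (p * X i) - algebraMap L F (eval w (p * X i)) =
        (aeval u p - algebraMap L F (eval w p)) * u i +
          algebraMap L F (eval w p) * (u i - algebraMap L F (w i)) := by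
      rw [map_mul, map_mul, aeval_X, eval_X, map_mul]
      ring
    rw [e]
    refine O.valuation.map_add_lt ?_ ?_
    · rw [map_mul]
      exact (mul_le_of_le_one_right' hu).trans_lt hp
    · rw [map_mul]
      exact (mul_le_of_le_one_left' ((O.valuation_le_one_iff _).mpr (hO _))).trans_lt (h i)

/-- Projecting along a vector `w` at which the homogeneous relation `g` does not vanish does not make
`z` smaller in any valuation: otherwise `z / z 0` would be congruent to `w` modulo the maximal
ideal, and so would be the values of `g`, of which the first is zero and the second a unit. -/
theorem exists_valuation_le_sub_mul (hO : ∀ c : L, algebraMap L F c ∈ O) {m r : ℕ}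
    {z : Fin (m + 1) → F} {g : MvPolynomial (Fin (m + 1)) L} (hg : g.IsHomogeneous r)
    (hgz : aeval z g = 0) {w : Fin (m + 1) → L} (hgw : eval w g ≠ 0) (hw : w 0 = 1) (hm : 0 < m) :
    ∃ i : Fin m, O.valuation (z 0) ≤ O.valuation (z i.succ - algebraMap L F (w i.succ) * z 0) := by
  by_contra! hlt
  have hz : z 0 ≠ 0 := by
    intro h0
    have := hlt ⟨0, hm⟩
    rw [h0, map_zero] at this
    exact not_lt_zero this
  have h1 := valuation_aeval_sub_lt_one (O := O) hO (u := fun i => (z 0)⁻¹ * z i) (w := w)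
    (fun i => by
      refine Fin.cases ?_ (fun i => ?_) i
      · simp [hw, hz]
      · have e : (z 0)⁻¹ * z i.succ - algebraMap L F (w i.succ) =
            (z i.succ - algebraMap L F (w i.succ) * z 0) / z 0 := by
          field_simp
        rw [e, map_div₀]
        exact (div_lt_one₀ (zero_lt_iff.mpr ((O.valuation.ne_zero_iff).mpr hz))).mpr (hlt i)) g
  rw [aeval_mul_left_of_isHomogeneous hg, hgz, mul_zero, zero_sub, Valuation.map_neg,
    valuation_algebraMap_eq_one hO hgw] at h1
  exact lt_irrefl _ h1

end Valuation

/-- **Noether normalization by linear projections.** Finitely many elements of a field of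
transcendence degree `d` can be replaced by `d + 1` linear combinations without becoming smaller in
any valuation. Over an infinite field, as long as there are more than `d + 1` elements, one of them
can be eliminated. -/
theorem exists_linComb_forall_valuation_le {L F : Type u} [Field L] [Infinite L] [Field F]
    [Algebra L F] {n d : ℕ} (hd : Algebra.trdeg L F = d) (z : Fin n → F) :
    ∃ N : Fin (d + 1) → Fin n → L, ∀ O : ValuationSubring F, (∀ c : L, algebraMap L F c ∈ O) →
      ∀ j, ∃ i, O.valuation (z j) ≤ O.valuation (linComb z N i) := by
  suffices h : ∀ k, ∀ N : Fin (d + 1 + k) → Fin n → L,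
      (∀ O : ValuationSubring F, (∀ c : L, algebraMap L F c ∈ O) →
        ∀ j, ∃ i, O.valuation (z j) ≤ O.valuation (linComb z N i)) →
      ∃ N : Fin (d + 1) → Fin n → L, ∀ O : ValuationSubring F, (∀ c : L, algebraMap L F c ∈ O) →
        ∀ j, ∃ i, O.valuation (z j) ≤ O.valuation (linComb z N i) by
    -- Start from the given elements, padded with zeros if there are fewer than `d + 1`.
    refine h n (Fin.append 0 fun i => Pi.single i 1) fun O _ j => ⟨Fin.natAdd _ j, le_of_eq ?_⟩
    congr 1
    simp [linComb, Pi.single_apply]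
  intro k
  induction k with
  | zero => exact fun N hN => ⟨N, hN⟩
  | succ k ih =>
    intro N hN
    change Fin (d + 1 + k + 1) → Fin n → L at N
    obtain ⟨r, g, hg, hg0, hgz⟩ := exists_isHomogeneous_relation hd (by omega) (linComb z N)
    -- The factor `X 0` makes sure that `w' 0 ≠ 0`, so that `w'` can be scaled to `w 0 = 1`.
    obtain ⟨w', hw'⟩ : ∃ w, eval w (g * X 0) ≠ 0 := by
      by_contra! h
      exact mul_ne_zero hg0 (X_ne_zero 0) (funext fun w => by rw [h, map_zero])
    rw [map_mul, eval_X] at hw'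
    have hw0 := right_ne_zero_of_mul hw'
    let w : Fin (d + 1 + k + 1) → L := fun i => (w' 0)⁻¹ * w' i
    have hgw : eval w g ≠ 0 := by
      have := aeval_mul_left_of_isHomogeneous hg (w' 0)⁻¹ w'
      rw [aeval_eq_eval, aeval_eq_eval] at this
      change eval w g = _ * eval w' g at this
      rw [this]
      exact mul_ne_zero (pow_ne_zero _ (inv_ne_zero hw0)) (left_ne_zero_of_mul hw')
    let N' : Fin (d + 1 + k) → Fin n → L := fun i => N i.succ - w i.succ • N 0
    have hN' : ∀ i, linComb z N' i =
        linComb z N i.succ - algebraMap L F (w i.succ) * linComb z N 0 := by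
      intro i
      simp [linComb, N', sub_smul, Finset.sum_sub_distrib, mul_smul, Finset.smul_sum,
        ← Algebra.smul_def]
    refine ih N' fun O hO j => ?_
    obtain ⟨i₀, hi₀⟩ := exists_valuation_le_sub_mul hO hg hgz hgw (inv_mul_cancel₀ hw0) (by omega)
    rw [← hN'] at hi₀
    obtain ⟨i, hi⟩ := hN O hO j
    revert hi
    refine Fin.cases (fun hi => ⟨i₀, hi.trans hi₀⟩) (fun i hi => ?_) i
    have e : linComb z N i.succ = linComb z N' i + algebraMap L F (w i.succ) * linComb z N 0 := by
      rw [hN']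
      ring
    have h0 : O.valuation (algebraMap L F (w i.succ) * linComb z N 0) ≤
        O.valuation (linComb z N' i₀) := by
      rw [map_mul]
      exact (mul_le_of_le_one_left' ((O.valuation_le_one_iff _).mpr (hO _))).trans hi₀
    rcases le_total (O.valuation (linComb z N' i)) (O.valuation (linComb z N' i₀)) with h | h
    · exact ⟨i₀, hi.trans (e ▸ O.valuation.map_add_le h h0)⟩
    · exact ⟨i, hi.trans (e ▸ O.valuation.map_add_le le_rfl (h0.trans h))⟩

end Escape

/-! ### Equations of bounded degree -/

namespace Escape

open MvPolynomial

/-- The relations between `d + 1` elements over which a field of transcendence degree `d` is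
algebraic form a principal ideal, generated by any irreducible relation: otherwise the dimension
would drop twice. -/
theorem dvd_of_aeval_eq_zero {L F : Type u} [Field L] [Field F] [Algebra L F] {d : ℕ}
    (hd : Algebra.trdeg L F = d) {l : Fin (d + 1) → F}
    (hl : Algebra.IsAlgebraic (aeval (R := L) l).range F) {f h : MvPolynomial (Fin (d + 1)) L}
    (hf : Irreducible f) (hfl : aeval l f = 0) (hhl : aeval l h = 0) : f ∣ h := by
  by_contra hdvd
  let A := (aeval (R := L) l).range
  have : Algebra.FiniteType L A :=
    Algebra.FiniteType.of_surjective _ (aeval (R := L) l).rangeRestrict_surjective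
  have hA : ringKrullDim A = d := by
    rw [trdeg_eq_of_ringKrullDim_eq L, ← hd, ← trdeg_add_eq L A (A := F), trdeg_eq_zero (R := A),
      add_zero]
  have hprime : (Ideal.span {f}).IsPrime :=
    (Ideal.span_singleton_prime hf.ne_zero).mpr hf.prime
  let φ : MvPolynomial (Fin (d + 1)) L ⧸ Ideal.span {f} →+* A :=
    Ideal.Quotient.lift _ (aeval (R := L) l).rangeRestrict.toRingHom fun a ha => by
      obtain ⟨b, rfl⟩ := Ideal.mem_span_singleton.mp ha
      refine Subtype.ext ?_
      change aeval l (f * b) = 0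
      rw [map_mul, hfl, zero_mul]
  have h1 := ringKrullDim_succ_le_of_surjective φ
    (Ideal.Quotient.lift_surjective_of_surjective _ _
      (aeval (R := L) l).rangeRestrict_surjective)
    (r := Ideal.Quotient.mk _ h) (mem_nonZeroDivisors_of_ne_zero (by
      rwa [Ne, Ideal.Quotient.eq_zero_iff_mem, Ideal.mem_span_singleton]))
    (Subtype.ext hhl)
  have h2 := ringKrullDim_quotient_succ_le_of_nonZeroDivisor
    (mem_nonZeroDivisors_of_ne_zero hf.ne_zero)
  rw [MvPolynomial.ringKrullDim_of_isNoetherianRing, ringKrullDim_eq_zero_of_field, zero_add,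
    Nat.card_fin] at h2
  rw [hA] at h1
  have h3 := (add_le_add_left h1 1).trans h2
  have h4 : d + 1 + 1 ≤ d + 1 := by exact_mod_cast h3
  omega

/-- If, in every valuation that is nonnegative on `L[l]`, so are the generators `x` of `F`, then `F`
is algebraic over `L[l]`. -/
theorem isAlgebraic_range_aeval {L F : Type*} [Field L] [Field F] [Algebra L F] {ι κ : Type*}
    {x : κ → F} (hgen : IntermediateField.adjoin L (Set.range x) = ⊤) {l : ι → F}
    (hl : ∀ O : ValuationSubring F, (∀ q : MvPolynomial ι L, aeval l q ∈ O) → ∀ j, x j ∈ O) :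
    Algebra.IsAlgebraic (aeval (R := L) l).range F := by
  let A := (aeval (R := L) l).range
  have hx : ∀ j, IsAlgebraic A (x j) := by
    intro j
    have hmem : x j ∈ ⨅ O : {O : ValuationSubring F // (A : Set F) ⊆ O.toSubring},
        O.1.toSubring := by
      rw [Subring.mem_iInf]
      exact fun O => hl O.1 (fun q => O.2 ⟨q, rfl⟩) j
    rw [iInf_valuationSubring_superset] at hmem
    have hcl : Subring.closure (A : Set F) = A.toSubring := Subring.closure_eq A.toSubring
    rw [hcl] at hmem
    exact IsIntegral.isAlgebraic (R := A) hmem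
  refine ⟨fun z => ?_⟩
  have hz : z ∈ IntermediateField.adjoin L (Set.range x) := hgen ▸ IntermediateField.mem_top
  induction hz using IntermediateField.adjoin_induction with
  | mem z hz =>
    obtain ⟨j, rfl⟩ := hz
    exact hx j
  | algebraMap c => exact isAlgebraic_algebraMap (algebraMap L A c)
  | add a b _ _ ha hb => exact ha.add hb
  | inv a _ ha => exact ha.inv
  | mul a b _ _ ha hb => exact ha.mul hb

/-- A point `c` at which every relation of `l` vanishes is the centre of a valuation: by Chevalley's
theorem, some valuation ring dominates the local ring of `L[l]` at `c`. -/
theorem exists_valuationSubring_centre {L F ι : Type*} [Field L] [Field F] [Algebra L F]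
    {l : ι → F} {c : ι → L}
    (hc : ∀ h : MvPolynomial ι L, aeval l h = 0 → eval c h = 0) :
    ∃ O : ValuationSubring F, (∀ a : L, algebraMap L F a ∈ O) ∧
      ∀ i, O.valuation (l i - algebraMap L F (c i)) < 1 := by
  let π : MvPolynomial ι L →+* F := (aeval (R := L) l).toRingHom
  let I : Ideal π.range := (RingHom.ker (eval c)).map π.rangeRestrict
  have hI : I ≠ ⊤ := by
    intro h
    have h1 : (1 : π.range) ∈ I := h ▸ Submodule.mem_top
    rw [Ideal.mem_map_iff_of_surjective _ π.rangeRestrict_surjective] at h1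
    obtain ⟨q, hq, hq1⟩ := h1
    have h2 := hc (q - 1) (by
      rw [map_sub, map_one, sub_eq_zero]
      exact congrArg Subtype.val hq1)
    rw [map_sub, map_one, (RingHom.mem_ker).mp hq, zero_sub, neg_eq_zero] at h2
    exact one_ne_zero h2
  obtain ⟨O, hAle, hle⟩ := Ideal.image_subset_nonunits_valuationSubring I hI
  refine ⟨O, fun a => hAle ⟨C a, aeval_C _ _⟩, fun i => ?_⟩
  rw [← ValuationSubring.mem_nonunits_iff]
  refine hle ⟨π.rangeRestrict (X i - C (c i)), Ideal.mem_map_of_mem _ ?_, ?_⟩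
  · simp [RingHom.mem_ker]
  · change aeval l (X i - C (c i)) = _
    rw [map_sub, aeval_X, aeval_C]

/-- **A variety of bounded dimension and degree is cut out by hypersurfaces of bounded degree.**
If `y` is not in `V`, then `V` has a linear projection to a space of dimension `d + 1` whose image
is contained in a hypersurface of degree at most `(d + 1) D` that avoids the image of `y`: if the image
of `y` were on the hypersurface, it would be the centre of a valuation of the function field, and
since the differences of the coordinates to those of `y` are not made smaller by the projection,
`y` would be the centre of this valuation on `V`. -/
theorem exists_totalDegree_le_of_notMem {L : Type u} [Field L] [IsAlgClosed L] {n d D : ℕ}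
    {V : Set (Fin n → L)} (hV : IsIrreducibleVariety V) (hdim : dim V = d)
    (hdeg : HasDegree V D) {y : Fin n → L} (hy : y ∉ V) :
    ∃ f : MvPolynomial (Fin n) L, f.totalDegree ≤ (d + 1) * D ∧ (∀ v ∈ V, eval v f = 0) ∧
      eval y f ≠ 0 := by
  obtain ⟨F, _, _, _, x, hx, hgen, hd⟩ := exists_isGenericPoint hV hdim
  obtain ⟨N, hN⟩ := exists_linComb_forall_valuation_le hd fun j => x j - algebraMap L F (y j)
  have hsub : ∀ i, linComb (fun j => x j - algebraMap L F (y j)) N i =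
      linComb x N i - algebraMap L F (linComb y N i) := by
    intro i
    simp [linComb, Algebra.smul_def, mul_sub]
  obtain ⟨g, hg0, hgdeg, hg⟩ := exists_relation_totalDegree_le hV.1 hdim hdeg hx hgen hd N
  obtain ⟨f, hf0, hf, hmin⟩ := exists_minimal_relation hd (linComb x N)
  have hirr := irreducible_of_forall_totalDegree_le hmin hf0 hf
  refine ⟨bind₁ (fun i => ∑ j, C (N i j) * X j) f,
    (totalDegree_bind₁_le (fun i => totalDegree_linear_le _) f).trans ((hmin g hg0 hg).trans hgdeg),
    fun v hv => ?_, fun hyf => ?_⟩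
  · have h1 := (hx.aeval_linComb N f).mp hf v hv
    rwa [← aeval_bind₁_linear, aeval_eq_eval] at h1
  · have hfy : eval (linComb y N) f = 0 := by
      have h1 := aeval_bind₁_linear N f y
      rw [aeval_eq_eval, aeval_eq_eval] at h1
      exact h1.symm.trans hyf
    -- The projection is finite on `V`, so its image is a hypersurface.
    have hint : ∀ O : ValuationSubring F,
        (∀ q : MvPolynomial (Fin (d + 1)) L, aeval (linComb x N) q ∈ O) → ∀ j, x j ∈ O := by
      intro O hO j
      have hO' : ∀ c : L, algebraMap L F c ∈ O := fun c => by
        simpa using hO (C c)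
      obtain ⟨i, hi⟩ := hN O hO' j
      have h1 : x j - algebraMap L F (y j) ∈ O := by
        refine (O.valuation_le_one_iff _).mp (hi.trans ((O.valuation_le_one_iff _).mpr ?_))
        rw [hsub]
        exact sub_mem (by simpa using hO (X i)) (hO' _)
      simpa using add_mem h1 (hO' (y j))
    obtain ⟨O, hO, hlt⟩ := exists_valuationSubring_centre (L := L) (l := linComb x N)
      (c := linComb y N) fun h hh => by
        obtain ⟨b, rfl⟩ :=
          dvd_of_aeval_eq_zero hd (isAlgebraic_range_aeval hgen hint) hirr hf hh
        rw [map_mul, hfy, zero_mul]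
    have hy' : y ∉ zeroLocus L (vanishingIdeal L V) := by rwa [zeroLocus_vanishingIdeal hV.1]
    obtain ⟨q, hq, hqy⟩ : ∃ q ∈ vanishingIdeal L V, aeval y q ≠ 0 := by
      by_contra! h
      exact hy' h
    have h1 := valuation_aeval_sub_lt_one hO (u := x) (w := y) (fun j => by
      obtain ⟨i, hi⟩ := hN O hO j
      rw [hsub] at hi
      exact hi.trans_lt (hlt i)) q
    rw [(hx q).mpr hq, zero_sub, Valuation.map_neg, valuation_algebraMap_eq_one hO
      (by rwa [aeval_eq_eval] at hqy)] at h1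
    exact lt_irrefl _ h1

end Escape

/-! ### Escape from varieties -/

namespace Escape

open MvPolynomial

/-- **Escape from varieties over an algebraically closed field.** Each `V i` lies in a subspace of
bounded dimension. Either `x` escapes from the union of these subspaces, or its orbit lies in
boundedly many subspaces of bounded dimension; then it escapes from the `V i` by linear algebra,
because they are cut out by polynomials of bounded degree. -/
theorem exists_escapesIn_iUnion (m : ℕ) (d D : Fin m → ℕ) :
    ∃ k : ℕ, ∀ {L : Type u} {G : Type v} [Field L] [IsAlgClosed L] [Group G] {n : ℕ}
      (ρ : Representation L G (Fin n → L)) {A : Set G}, Subgroup.closure A = ⊤ →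
      ∀ (x : Fin n → L) (V : Fin m → Set (Fin n → L)), (∀ i, IsIrreducibleVariety (V i)) →
      (∀ i, dim (V i) = d i) → (∀ i, HasDegree (V i) (D i)) → (∃ g, ρ g x ∉ ⋃ i, V i) →
      EscapesIn ρ A x (⋃ i, V i) k := by
  classical
  let N := ∑ i, monomialCount (d i) ((d i + 1) * D i)
  obtain ⟨k, hk⟩ := exists_escapesIn_iUnion_submodule.{u, v, u} N m m
  refine ⟨max k (k * monomialCount N (∑ i, (d i + 1) * D i)),
    fun {L G} _ _ _ n ρ A hA x V hV hdim hdeg hx => ?_⟩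
  choose U hUN hVU using fun i => exists_submodule_finrank_le (hV i) (hdim i) (hdeg i)
  have hY : (Finset.univ.image U).card ≤ m := Finset.card_image_le.trans_eq (by simp)
  have hYN : ∀ W ∈ Finset.univ.image U, Module.finrank L W ≤ N := by
    intro W hW
    obtain ⟨i, -, rfl⟩ := Finset.mem_image.mp hW
    exact (hUN i).trans (Finset.single_le_sum
      (f := fun i => monomialCount (d i) ((d i + 1) * D i)) (fun _ _ => Nat.zero_le _)
      (Finset.mem_univ i))
  rcases hk ρ A x hA (Finset.univ.image U) hYN hY
    ((Finset.card_filter_le _ _).trans hY) with ⟨Z, hZ, hZN, hxZ⟩ | h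
  · refine (escapesIn_of_orbit_subset ρ hA Z hZ hZN hxZ (m := ∑ i, (d i + 1) * D i)
      (fun y hy => ?_) hx).mono (le_max_right _ _)
    rw [Set.mem_iUnion, not_exists] at hy
    choose f hf hfV hfy using fun i =>
      exists_totalDegree_le_of_notMem (hV i) (hdim i) (hdeg i) (hy i)
    refine ⟨∏ i, f i, (totalDegree_finsetProd _ _).trans (Finset.sum_le_sum fun i _ => hf i),
      fun w hw => ?_, ?_⟩
    · obtain ⟨i, hi⟩ := Set.mem_iUnion.mp hw
      rw [map_prod]
      exact Finset.prod_eq_zero (Finset.mem_univ i) (hfV i w hi)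
    · rw [map_prod]
      exact Finset.prod_ne_zero_iff.mpr fun i _ => hfy i
  · refine (h.mono (le_max_left _ _)).anti (Set.iUnion_subset fun i => (hVU i).trans ?_)
    exact Set.subset_biUnion_of_mem (u := fun W : Submodule L (Fin n → L) => (W : Set (Fin n → L)))
      (Finset.mem_coe.mpr (Finset.mem_image_of_mem U (Finset.mem_univ i)))

/-- The action of `G` on the points with coordinates in the algebraic closure. -/
noncomputable def extendScalars {K G : Type*} [Field K] [Group G] {n : ℕ}
    (φ : G →* Matrix.GeneralLinearGroup (Fin n) K) :
    Representation (AlgebraicClosure K) G (Fin n → AlgebraicClosure K) :=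
  Matrix.toLinAlgEquiv'.toAlgHom.toMonoidHom.comp
    ((RingHom.mapMatrix (algebraMap K (AlgebraicClosure K))).toMonoidHom.comp
      ((Units.coeHom _).comp φ))

theorem extendScalars_apply {K G : Type*} [Field K] [Group G] {n : ℕ}
    (φ : G →* Matrix.GeneralLinearGroup (Fin n) K) (g : G) (x : Fin n → K) :
    extendScalars φ g (fun i => algebraMap K (AlgebraicClosure K) (x i)) =
      fun i => algebraMap K (AlgebraicClosure K) (Matrix.mulVec (φ g).val x i) := by
  ext i
  rw [RingHom.map_mulVec]
  rfl

/-- Escaping in `k` steps gives a positive proportion of good words of length `k + 1`. -/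
theorem EscapesIn.max_le_encard {L E G : Type*} [Field L] [AddCommGroup E] [Module L E] [Group G]
    {ρ : Representation L G E} {A : Set G} {x : E} {Y : Set E} {k l : ℕ}
    (h : EscapesIn ρ A x Y k) (hkl : k ≤ l) :
    max 1 ((((l : ℝ≥0) + 1)⁻¹ : ℝ≥0) * (A.encard : ℝ≥0∞)) ≤
      (({g : G | g ∈ (A ∪ A⁻¹ ∪ {1}) ^ (l + 1) ∧ ρ g x ∉ Y}.encard : ℕ∞) : ℝ≥0∞) := by
  have hl := h.mono hkl
  refine max_le (by exact_mod_cast hl.one_le_encard) ?_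
  have h1 : (A.encard : ℝ≥0∞) ≤
      (l * {g : G | g ∈ (A ∪ A⁻¹ ∪ {1}) ^ (l + 1) ∧ ρ g x ∉ Y}.encard : ℕ∞) := by
    exact_mod_cast hl.encard_le
  rw [ENNReal.coe_inv (by positivity), mul_comm, ← div_eq_mul_inv]
  refine ENNReal.div_le_of_le_mul' (h1.trans ?_)
  push_cast
  gcongr
  exact le_self_add

end Escape

theorem mainTheorem5 (m : ℕ) (d D : Fin m → ℕ) :
    ∃ (k : ℕ) (c : ℝ≥0), 0 < c ∧
      ∀ (K : Type u) [Field K] (n : ℕ) (G : Type v) [Group G]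
        (φ : G →* Matrix.GeneralLinearGroup (Fin n) K)
        (A : Set G) (_hA : Subgroup.closure A = ⊤)
        (W : Set (Fin n → AlgebraicClosure K)) (_hW : Escape.IsVariety W)
        (_hW' : W ⊂ Set.univ)
        (V : Fin m → Set (Fin n → AlgebraicClosure K))
        (_hV : Escape.AreIrreducibleComponents W V)
        (_hdim : ∀ i, Escape.dim (V i) = d i)
        (_hdeg : ∀ i, Escape.HasDegree (V i) (D i))
        (x : Fin n → K)
        (_hx : ¬ Set.range (fun g : G => Matrix.mulVec (φ g).val x) ⊆ Escape.rationalPoints K W),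
        max 1 ((c : ℝ≥0∞) * (A.encard : ℝ≥0∞)) ≤
          (({g : G | g ∈ (A ∪ A⁻¹ ∪ {1}) ^ k ∧
            Matrix.mulVec (φ g).val x ∉ Escape.rationalPoints K W}.encard : ℕ∞) : ℝ≥0∞) := by
  obtain ⟨k, hk⟩ := Escape.exists_escapesIn_iUnion.{u, v} m d D
  refine ⟨k + 1, ((k : ℝ≥0) + 1)⁻¹, by positivity, ?_⟩
  intro K _ n G _ φ A hA W _ _ V hV hdim hdeg x hx
  obtain ⟨hirr, hWV, -⟩ := hV
  have hmem : ∀ g, Matrix.mulVec (φ g).val x ∉ Escape.rationalPoints K W ↔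
      Escape.extendScalars φ g (fun i => algebraMap K (AlgebraicClosure K) (x i)) ∉ ⋃ i, V i := by
    intro g
    rw [Escape.extendScalars_apply, ← hWV]
    rfl
  have hx' : ∃ g, Escape.extendScalars φ g
      (fun i => algebraMap K (AlgebraicClosure K) (x i)) ∉ ⋃ i, V i := by
    obtain ⟨_, ⟨g, rfl⟩, hg⟩ := Set.not_subset.mp hx
    exact ⟨g, (hmem g).mp hg⟩
  simp only [hmem]
  exact (hk (Escape.extendScalars φ) hA _ V hirr hdim hdeg hx').max_le_encard le_rfl
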